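/- **Theorem 6.3.** Let $k$ be a field of characteristic $\neq 2$, let $n\ge 1$, and let $B_n$ (resp. $C_n$) be the quiver whose underlying graph is a chain of $n$ vertices $1 - 2 - \cdots - n$ with an arbitrary orientation of the edges, where the last vertex $n$ has the sign $\sigma(n)=+1$ (resp. $\sigma(n)=-1$) and all other vertices and all arrows are unsigned (have sign $0$). Let $\widetilde Q$ be the associated symmetric quiver: one adds a vertex $i^*$ for each unsigned vertex $i$ and an arrow $\varphi^*: q^*\to p^*$ for each arrow $\varphi:p\to q$ (with $n^*=n$, $i^{**}=i$, $\varphi^{**}=\varphi$); new vertices are unsigned. The dual $V^*$ of a finite-dimensional representation $V$ of $\widetilde Q$ over $k$ is given by $V^*(i)=V(i^*)^*$ and $V^*(\varphi)=s_\varphi V(\varphi^*)^*$, where $s_\varphi=-1$ if the head of $\varphi$ has sign $-1$, and $s_\varphi=1$ otherwise. A representation $V$ is *symmetric* if there are isomorphisms $J_i:V(i)\to V(i^*)^*$ with $J_{i^*}=(J_i)^*$ for $i\ne i^*$ and $(J_n)^*=\sigma(n)J_n$, which form an isomorphism of representations $V\to V^*$. A nonzero symmetric representation is *indecomposable symmetric*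 if it is not isomorphic to a direct sum of two nonzero symmetric representations. Let $D\subset \mathbb Z_{\ge 0}^{\widetilde Q_0}$ be the set of dimension vectors of the indecomposable symmetric representations of $\widetilde Q$. Then $D\cup(-D)$ is a finite, reduced, crystallographic root system in the $\mathbb Q$-span of $D$, of type $B_n$ (resp. $C_n$), and $D$ is its set of positive roots with respect to the base $\beta_1,\dots,\beta_n$, where $\beta_i=\varepsilon_i+\varepsilon_{i^*}$ for $i<n$ and $\beta_n=\varepsilon_n$ (resp. $\beta_n=2\varepsilon_n$), $\varepsilon_i$ being the standard basis vectors. Explicitly, the Cartan matrix $(\langle\beta_i,\beta_j^\vee\rangle)_{i,j}$ of this base is the standard one of type $B_n$, with $\beta_n$ the short simple root (resp. of type $C_n$, with $\beta_n$ the long simple root; for $n=1$ both are the matrix $(2)$). -/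

import Mathlib

universe u

noncomputable section

/-- A signed quiver: a finite quiver with vertices `V` and arrows `E`, an involution `twin` of the
vertices whose two-element orbits are the pairs of twins, and signs in `{-1, 0, 1}` on vertices and
arrows. A vertex or an arrow is called signed if its sign is nonzero. -/
structure SignedQuiver where
  V : Type
  E : Type
  finite_V : Finite V
  finite_E : Finite E
  tail : E → V
  head : E → V
  twin : V → V
  twin_twin : ∀ i, twin (twin i) = i
  vsign : V → SignType
  esign : E → SignType
  /-- twins are unsigned -/
  vsign_eq_zero : ∀ i, twin i ≠ i → vsign i = 0
  /-- a non-loop arrow is signed if and only if its end vertices are twins -/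
  esign_ne_zero_iff : ∀ a, tail a ≠ head a → (esign a ≠ 0 ↔ twin (tail a) = head a)
  /-- a loop is signed if and only if its vertex is signed -/
  esign_loop_ne_zero_iff : ∀ a, tail a = head a → (esign a ≠ 0 ↔ vsign (tail a) ≠ 0)

namespace SignedQuiver

variable (Q : SignedQuiver)

/-- A vertex that is unsigned and is not one of a pair of twins. -/
def IsSingleUnsigned (i : Q.V) : Prop := Q.twin i = i ∧ Q.vsign i = 0

/-- The vertices of the symmetric quiver `Q̃`: the vertices `of i` of `Q`, together with a new vertex
`i*` for each single unsigned vertex `i` of `Q`. -/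
inductive Double : Type
  | of (i : Q.V) : Double
  | new (i : Q.V) (h : Q.IsSingleUnsigned i) : Double

/-- The arrows of `Q̃`: those of `Q`, together with a new arrow `φ*` for each unsigned arrow `φ`. -/
inductive DoubleArrow : Type
  | of (a : Q.E) : DoubleArrow
  | new (a : Q.E) (h : Q.esign a = 0) : DoubleArrow

variable {Q}

namespace Double

open Classical in
/-- The involution on the vertices of `Q̃`. -/
def star : Q.Double → Q.Double
  | of i => if h : Q.IsSingleUnsigned i then new i h else of (Q.twin i)
  | new i _ => of i

/-- The signs of the vertices of `Q̃`; the new vertices are unsigned. -/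
def sign : Q.Double → SignType
  | of i => Q.vsign i
  | new _ _ => 0

theorem star_star (i : Q.Double) : i.star.star = i := by
  cases i with
  | of i =>
    by_cases h : Q.IsSingleUnsigned i
    · simp [star, h]
    · have h' : ¬ Q.IsSingleUnsigned (Q.twin i) := by
        rintro ⟨h1, h2⟩
        rw [Q.twin_twin] at h1
        rw [← h1] at h2
        exact h ⟨h1.symm, h2⟩
      simp [star, h, h', Q.twin_twin]
  | new i h => simp [star, h]

/-- Along a signed arrow the involution of the vertices interchanges tail and head. -/
theorem star_of_tail {a : Q.E} (h : Q.esign a ≠ 0) : (of (Q.tail a)).star = of (Q.head a) := by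
  by_cases hl : Q.tail a = Q.head a
  · have h1 := (Q.esign_loop_ne_zero_iff a hl).1 h
    have h2 : Q.twin (Q.tail a) = Q.tail a := by
      by_contra hne
      exact h1 (Q.vsign_eq_zero _ hne)
    have h3 : ¬ Q.IsSingleUnsigned (Q.tail a) := fun hs => h1 hs.2
    simp only [star, h3, dite_false]
    rw [h2, hl]
  · have h1 := (Q.esign_ne_zero_iff a hl).1 h
    have h3 : ¬ Q.IsSingleUnsigned (Q.tail a) := fun hs => hl (hs.1.symm.trans h1)
    simp only [star, h3, dite_false]
    rw [h1]

end Double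

namespace DoubleArrow

/-- The tail of an arrow of `Q̃`; for `φ : p → q` unsigned, `φ*` goes from `q*` to `p*`. -/
def tail : Q.DoubleArrow → Q.Double
  | of a => Double.of (Q.tail a)
  | new a _ => (Double.of (Q.head a)).star

/-- The head of an arrow of `Q̃`. -/
def head : Q.DoubleArrow → Q.Double
  | of a => Double.of (Q.head a)
  | new a _ => (Double.of (Q.tail a)).star

open Classical in
/-- The involution on the arrows of `Q̃`; it fixes the signed arrows. -/
def star : Q.DoubleArrow → Q.DoubleArrow
  | of a => if h : Q.esign a = 0 then new a h else of a
  | new a _ => of a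

/-- The signs of the arrows of `Q̃`; the new arrows are unsigned. -/
def sign : Q.DoubleArrow → SignType
  | of a => Q.esign a
  | new _ _ => 0

theorem tail_star (a : Q.DoubleArrow) : a.star.tail = a.head.star := by
  cases a with
  | of a =>
    by_cases h : Q.esign a = 0
    · simp [star, tail, head, h]
    · simp only [star, h, dite_false, tail, head]
      rw [← Double.star_of_tail h, Double.star_star]
  | new a h => simp [star, tail, head, Double.star_star]

theorem head_star (a : Q.DoubleArrow) : a.star.head = a.tail.star := by
  cases a with
  | of a =>
    by_cases h : Q.esign a = 0
    · simp [star, tail, head, h]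
    · simp only [star, h, dite_false, tail, head]
      rw [← Double.star_of_tail h]
  | new a h => simp [star, tail, head, Double.star_star]

end DoubleArrow

/-- The quiver `Q̃`. -/
instance : Quiver Q.Double where
  Hom i j := {a : Q.DoubleArrow // a.tail = i ∧ a.head = j}

/-- The involution of `Q̃` on arrows: `φ : i → j` goes to `φ* : j* → i*`. -/
def starHom {i j : Q.Double} (φ : i ⟶ j) : j.star ⟶ i.star :=
  ⟨φ.1.star, by rw [DoubleArrow.tail_star, φ.2.2], by rw [DoubleArrow.head_star, φ.2.1]⟩

open Classical in
/-- The sign `s_φ` in the definition of the dual representation: it is `-1` if exactly one of the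
arrow `φ` and its head has sign `-1`, and it is `1` otherwise. -/
def dualSign {i j : Q.Double} (φ : i ⟶ j) : ℤ :=
  if (φ.1.sign = -1 ∧ j.sign ≠ -1) ∨ (φ.1.sign ≠ -1 ∧ j.sign = -1) then -1 else 1

end SignedQuiver

/-- Finite-dimensional representations over `k` of a quiver with vertex set `X`. -/
structure QuiverRep (k : Type u) [Field k] (X : Type) [Quiver.{0, 0} X] where
  obj : X → Type u
  [addCommGroup : ∀ i, AddCommGroup (obj i)]
  [module : ∀ i, Module k (obj i)]
  [finite : ∀ i, Module.Finite k (obj i)]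
  map : ∀ {i j : X}, (i ⟶ j) → (obj i →ₗ[k] obj j)

namespace QuiverRep

attribute [instance] QuiverRep.addCommGroup QuiverRep.module QuiverRep.finite

variable {k : Type u} [Field k] {X : Type} [Quiver.{0, 0} X]

/-- The collection `H` of linear maps is a homomorphism from `U` to `W`. -/
def IsHom (U W : QuiverRep k X) (H : ∀ i, U.obj i →ₗ[k] W.obj i) : Prop :=
  ∀ (i j : X) (φ : i ⟶ j), W.map φ ∘ₗ H i = H j ∘ₗ U.map φ

/-- `U` and `W` are isomorphic as representations of the quiver. -/
def Isomorphic (U W : QuiverRep k X) : Prop :=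
  ∃ H : ∀ i, U.obj i ≃ₗ[k] W.obj i, IsHom U W fun i => (H i : U.obj i →ₗ[k] W.obj i)

/-- The direct sum of two representations. -/
def directSum (U W : QuiverRep k X) : QuiverRep k X where
  obj i := U.obj i × W.obj i
  map φ := (U.map φ).prodMap (W.map φ)

/-- The zero representation (up to isomorphism). -/
def IsZero (U : QuiverRep k X) : Prop := ∀ i, Subsingleton (U.obj i)

variable {Q : SignedQuiver}

/-- The dual of a representation of `Q̃`: `V*(i) = (V(i*))*` and `V*(φ) = s_φ V(φ*)*`. -/
def dual (V : QuiverRep k Q.Double) : QuiverRep k Q.Double where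
  obj i := Module.Dual k (V.obj i.star)
  map φ := SignedQuiver.dualSign φ • (V.map (SignedQuiver.starHom φ)).dualMap

/-- A signed form on the spaces `V(i)`: isomorphisms `J_i : V(i) → V(i*)*` with `J_{i*} = (J_i)*` if
`i ≠ i*`, and `(J_i)* = σ(i) J_i` if `i = i*`. The second vertex argument `j` of `form` is `i*`. -/
structure SignedForm (V : QuiverRep k Q.Double) where
  form : ∀ i j : Q.Double, i.star = j → (V.obj i ≃ₗ[k] Module.Dual k (V.obj j))
  form_of_ne : ∀ (i j : Q.Double) (h : i.star = j) (h' : j.star = i), i ≠ j →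
    ∀ (x : V.obj i) (y : V.obj j), form j i h' y x = form i j h x y
  form_of_fixed : ∀ (i : Q.Double) (h : i.star = i) (x y : V.obj i),
    form i i h y x = (i.sign : k) * form i i h x y

/-- The isomorphism `J_i : V(i) → V*(i)`. -/
def SignedForm.toDual {V : QuiverRep k Q.Double} (J : SignedForm V) (i : Q.Double) :
    V.obj i →ₗ[k] V.dual.obj i :=
  (J.form i i.star rfl : V.obj i →ₗ[k] Module.Dual k (V.obj i.star))

/-- A representation of `Q̃` is symmetric if for some signed form `J` the maps `J_i` are an
isomorphism from `V` to its dual. -/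
def IsSymmetric (V : QuiverRep k Q.Double) : Prop :=
  ∃ J : SignedForm V, IsHom V V.dual J.toDual

/-- Indecomposable symmetric representations: nonzero symmetric representations that are not
isomorphic to a direct sum of two nonzero symmetric representations. -/
def IsIndecomposableSymmetric (V : QuiverRep k Q.Double) : Prop :=
  V.IsSymmetric ∧ ¬ V.IsZero ∧
    ∀ U W : QuiverRep k Q.Double, U.IsSymmetric → W.IsSymmetric →
      V.Isomorphic (U.directSum W) → U.IsZero ∨ W.IsZero

end QuiverRep

namespace SignedQuiver

/-- The dimension vectors, in the space `ℚ^(Q̃₀)`, of the indecomposable symmetric representations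
of `Q̃` over `k`. -/
def symDims (k : Type u) [Field k] (Q : SignedQuiver) : Set (Q.Double → ℚ) :=
  {d | ∃ V : QuiverRep k Q.Double, V.IsIndecomposableSymmetric ∧
    ∀ i, d i = (Module.finrank k (V.obj i) : ℚ)}

open Classical in
/-- The vector `β_i` attached to the orbit of a vertex `i`: `ε_i`, `2 ε_i` or `ε_i + ε_{i*}` according
as the sign of `i` is `1`, `-1` or `0`. -/
def simpleVector (Q : SignedQuiver) (i : Q.V) : Q.Double → ℚ :=
  if Q.vsign i = 1 then Pi.single (Double.of i) 1
  else if Q.vsign i = -1 then Pi.single (Double.of i) 2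
  else Pi.single (Double.of i) 1 + Pi.single (Double.of i).star 1

/-- The signed quiver whose underlying graph is the chain `0 — 1 — ⋯ — n-1` without twins, in
which the last vertex has sign `s` and all other vertices and all arrows are unsigned. The arrow
between `a` and `a + 1` goes from `a` to `a + 1` if `o a` is true and from `a + 1` to `a` otherwise. -/
def chain (n : ℕ) (o : Fin (n - 1) → Bool) (s : SignType) : SignedQuiver where
  V := Fin n
  E := Fin (n - 1)
  finite_V := inferInstance
  finite_E := inferInstance
  tail a := if o a then ⟨a, by omega⟩ else ⟨a + 1, by omega⟩
  head a := if o a then ⟨a + 1, by omega⟩ else ⟨a, by omega⟩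
  twin i := i
  twin_twin _ := rfl
  vsign i := if (i : ℕ) + 1 = n then s else 0
  esign _ := 0
  vsign_eq_zero _ h := absurd rfl h
  esign_ne_zero_iff a h := by simpa using h
  esign_loop_ne_zero_iff a h := by
    exfalso
    cases ho : o a <;> simp [ho] at h

/-- The signed quiver `B_n`, with the orientation `o`. -/
def typeB (n : ℕ) (o : Fin (n - 1) → Bool) : SignedQuiver := chain n o 1

/-- The signed quiver `C_n`, with the orientation `o`. -/
def typeC (n : ℕ) (o : Fin (n - 1) → Bool) : SignedQuiver := chain n o (-1)

end SignedQuiver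

/-- `D` is the set of positive roots of a (finite, reduced, crystallographic) root system in the
`ℚ`-span of `D` with all roots `D ∪ -D`, with respect to the base `β`, whose Cartan matrix
`(⟨β_i, β_j^∨⟩)` is `A`. -/
def IsPositiveRootsOfType {X : Type} {n : ℕ} (D : Set (X → ℚ)) (A : Matrix (Fin n) (Fin n) ℤ)
    (β : Fin n → X → ℚ) : Prop :=
  ∃ (ι : Type) (_ : Finite ι)
    (P : RootPairing ι ℚ (Submodule.span ℚ D) (Module.Dual ℚ (Submodule.span ℚ D)))
    (_ : P.IsRootSystem) (_ : P.IsCrystallographic) (_ : P.IsReduced)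
    (b : P.Base) (e : Fin n ≃ b.support),
    (Set.range fun i => (P.root i : X → ℚ)) = D ∪ {d | -d ∈ D} ∧
    (fun i => (P.root i : X → ℚ)) '' {i | b.IsPos i} = D ∧
    (∀ i, (P.root (e i) : X → ℚ) = β i) ∧
    ∀ i j, b.cartanMatrix (e i) (e j) = A i j

end

/-! The quiver `Q̃` is a chain of m = 2n - 1 vertices which the involution reverses, so only its
middle vertex is fixed. A nonzero representation of a quiver of type A has a direct summand that is
thin on an interval S: a line at each vertex of S, zero elsewhere, with bijective arrows inside S.
Such a summand is recorded by vectors and functionals (`ThinSummand`); `exists_thinSummand` finds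
one by carrying a pair of subspaces Y < P along the chain until the two collapse.

Let V be symmetric with form J. The dual of a thin summand on S is a thin summand on the mirror
image S*. The composite of the maps between two thin summands is a scalar, constant along a
connected support, and it can be nonzero only if the supports agree. So if S ≠ S*, the summand and
its dual span a nondegenerate hyperbolic subrepresentation of dimension 1_S + 1_{S*}. If S = S*,
then S contains the middle vertex. For sign -1 the form there is alternating, the scalar is again
zero, and the dimension is 2·1_S. For sign +1 polarization, with 2 invertible, gives a compatible
family of vectors of nonzero norm, and its span has dimension 1_S. This is `exists_nondegenerateOn`.
A nondegenerate subrepresentation splits off with its orthogonal complement, so no other dimension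
vectors occur.

Conversely, all of them do occur. The thin representation on S, or its sum with its dual, is
symmetric, and its interval summands are supported on S or S*. A nonzero symmetric summand therefore
contains a subrepresentation which already has the full dimension vector. Together this gives
`symDims_eq`.

It remains to recognize these vectors. Let e_a correspond to the indicator of the symmetric interval
[a, 2n - 2 - a]. Then the dimension vectors are the images of e_a ± e_b for a < b and of t e_a, with
t = 1 for B_n and t = 2 for C_n (`symDims_chain`). For B_n these are, up to sign, the integral
vectors of square length 1 or 2, for which the axioms of a root system are immediate; C_n is
obtained by passing to coroots. -/

/-! ### Subrepresentations and thin summands of quiver representations -/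

namespace QuiverRep

variable {k : Type u} [Field k] {X : Type} [Quiver.{0, 0} X]

/-- The family `N` of subspaces is stable under the maps of `V`. -/
def IsSubrep (V : QuiverRep k X) (N : ∀ i, Submodule k (V.obj i)) : Prop :=
  ∀ (i j : X) (φ : i ⟶ j), ∀ x ∈ N i, V.map φ x ∈ N j

/-- The subrepresentation on a stable family of subspaces. -/
def sub (V : QuiverRep k X) (N : ∀ i, Submodule k (V.obj i)) (hN : V.IsSubrep N) :
    QuiverRep k X where
  obj i := N i
  map {i j} φ := (V.map φ).restrict (hN i j φ)

theorem isomorphic_directSum_sub (V : QuiverRep k X) {N N' : ∀ i, Submodule k (V.obj i)}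
    (hN : V.IsSubrep N) (hN' : V.IsSubrep N') (h : ∀ i, IsCompl (N i) (N' i)) :
    V.Isomorphic ((V.sub N hN).directSum (V.sub N' hN')) := by
  refine ⟨fun i => (Submodule.prodEquivOfIsCompl (N i) (N' i) (h i)).symm, ?_⟩
  intro i j φ
  refine LinearMap.ext fun x => ?_
  obtain ⟨⟨a, b⟩, rfl⟩ := (Submodule.prodEquivOfIsCompl (N i) (N' i) (h i)).surjective x
  apply (Submodule.prodEquivOfIsCompl (N j) (N' j) (h j)).injective
  change Submodule.prodEquivOfIsCompl (N j) (N' j) (h j)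
      (((V.sub N hN).directSum (V.sub N' hN')).map φ
        ((Submodule.prodEquivOfIsCompl (N i) (N' i) (h i)).symm
          (Submodule.prodEquivOfIsCompl (N i) (N' i) (h i) (a, b)))) =
    Submodule.prodEquivOfIsCompl (N j) (N' j) (h j)
      ((Submodule.prodEquivOfIsCompl (N j) (N' j) (h j)).symm
        (V.map φ (Submodule.prodEquivOfIsCompl (N i) (N' i) (h i) (a, b))))
  rw [LinearEquiv.apply_symm_apply, LinearEquiv.symm_apply_apply,
    Submodule.coe_prodEquivOfIsCompl', map_add]
  exact Submodule.coe_prodEquivOfIsCompl' (N j) (N' j) (h j) _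

/-- The inclusion of the first summand. -/
def inlMap (A B : QuiverRep k X) (i : X) : A.obj i →ₗ[k] (A.directSum B).obj i :=
  LinearMap.inl k (A.obj i) (B.obj i)

/-- The projection to the first summand. -/
def fstMap (A B : QuiverRep k X) (i : X) : (A.directSum B).obj i →ₗ[k] A.obj i :=
  LinearMap.fst k (A.obj i) (B.obj i)

theorem fstMap_inlMap (A B : QuiverRep k X) {i : X} (x : A.obj i) :
    A.fstMap B i (A.inlMap B i x) = x := rfl

theorem fstMap_map (A B : QuiverRep k X) {i j : X} (φ : i ⟶ j) (x : (A.directSum B).obj i) :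
    A.fstMap B j ((A.directSum B).map φ x) = A.map φ (A.fstMap B i x) := rfl

theorem map_inlMap (A B : QuiverRep k X) {i j : X} (φ : i ⟶ j) (x : A.obj i) :
    (A.directSum B).map φ (A.inlMap B i x) = A.inlMap B j (A.map φ x) :=
  Prod.ext rfl (map_zero (B.map φ))

/-- A family of vectors and a family of functionals which exhibit the one-dimensional thin
representation with support `S` as a direct summand of `V`; the arrows inside `S` act by the nonzero
scalars `scal`. -/
structure ThinSummand (V : QuiverRep k X) (S : Set X) where
  vec : ∀ i, V.obj i
  fn : ∀ i, Module.Dual k (V.obj i)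
  scal : ∀ {i j : X}, (i ⟶ j) → k
  scal_ne_zero : ∀ {i j : X} (φ : i ⟶ j), scal φ ≠ 0
  vec_eq_zero : ∀ i, i ∉ S → vec i = 0
  fn_eq_zero : ∀ i, i ∉ S → fn i = 0
  fn_vec : ∀ i, i ∈ S → fn i (vec i) = 1
  map_vec : ∀ {i j : X} (φ : i ⟶ j), i ∈ S → V.map φ (vec i) = scal φ • vec j
  fn_map : ∀ {i j : X} (φ : i ⟶ j), j ∈ S → ∀ x, fn j (V.map φ x) = scal φ * fn i x

/-- The full subquiver on `S` is nonempty and connected. -/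
def ConnectedOn (S : Set X) : Prop :=
  S.Nonempty ∧ ∀ T ⊆ S, T.Nonempty →
    (∀ (i j : X), (i ⟶ j) → i ∈ S → j ∈ S → (i ∈ T ↔ j ∈ T)) → T = S

/-- The part of S on which θ takes the value θ i is nonempty and closed under the arrows inside S,
hence all of S. -/
theorem ConnectedOn.eq_of_edges {S : Set X} (hS : ConnectedOn S) {α : Type*} (θ : X → α)
    (h : ∀ (i j : X), (i ⟶ j) → i ∈ S → j ∈ S → θ i = θ j) {i j : X} (hi : i ∈ S) (hj : j ∈ S) :
    θ i = θ j := by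
  have := hS.2 {x | x ∈ S ∧ θ i = θ x} (fun x hx => hx.1) ⟨i, hi, rfl⟩ (by
    intro a b φ ha hb
    simp [ha, hb, h a b φ ha hb])
  have hj' : j ∈ {x | x ∈ S ∧ θ i = θ x} := by rw [this]; exact hj
  exact hj'.2

namespace ThinSummand

variable {V : QuiverRep k X} {S S' : Set X}

theorem vec_ne_zero (t : ThinSummand V S) {i : X} (hi : i ∈ S) : t.vec i ≠ 0 := fun h => by
  have := t.fn_vec i hi
  simp [h] at this

/-- The composite of the maps between two thin summands, a scalar at each vertex. -/
def pairing (t : ThinSummand V S) (t' : ThinSummand V S') (i : X) : k :=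
  t'.fn i (t.vec i) * t.fn i (t'.vec i)

/-- Both sides compute the functional of t' at j on the image under φ of the vector of t at i. -/
theorem fn_vec_edge (t : ThinSummand V S) (t' : ThinSummand V S') {i j : X} (φ : i ⟶ j)
    (hi : i ∈ S) (hj : j ∈ S') :
    t.scal φ * t'.fn j (t.vec j) = t'.scal φ * t'.fn i (t.vec i) := by
  rw [← t'.fn_map φ hj, t.map_vec φ hi, map_smul, smul_eq_mul]

/-- The pairing is the scalar by which the composite t → t' → t acts, and this composite commutes
with φ. If both ends lie in S', the nonzero scalars of φ cancel; if one end leaves S', a factor of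
the pairing at the other end is forced to vanish. -/
theorem pairing_edge (t : ThinSummand V S) (t' : ThinSummand V S') {i j : X} (φ : i ⟶ j)
    (hi : i ∈ S) (hj : j ∈ S) : t.pairing t' i = t.pairing t' j := by
  have h1 := t.scal_ne_zero φ
  have h2 := t'.scal_ne_zero φ
  unfold pairing
  by_cases hi' : i ∈ S' <;> by_cases hj' : j ∈ S'
  · have e1 := fn_vec_edge t t' φ hi hj'
    have e2 := fn_vec_edge t' t φ hi' hj
    apply mul_left_cancel₀ (mul_ne_zero h1 h2)
    linear_combination (-t'.scal φ * t.fn j (t'.vec j)) * e1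
      - (t'.scal φ * t'.fn i (t.vec i)) * e2
  · have e2 := fn_vec_edge t' t φ hi' hj
    rw [t'.vec_eq_zero j hj'] at e2 ⊢
    simp only [map_zero, mul_zero] at e2 ⊢
    simp [(mul_eq_zero.1 e2.symm).resolve_left h1]
  · have e1 := fn_vec_edge t t' φ hi hj'
    rw [t'.fn_eq_zero i hi'] at e1 ⊢
    simp only [LinearMap.zero_apply, mul_zero, zero_mul] at e1 ⊢
    simp [(mul_eq_zero.1 e1).resolve_left h1]
  · rw [t'.vec_eq_zero j hj', t'.vec_eq_zero i hi']
    simp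

theorem pairing_const (t : ThinSummand V S) (t' : ThinSummand V S') (hS : ConnectedOn S) {i j : X}
    (hi : i ∈ S) (hj : j ∈ S) : t.pairing t' i = t.pairing t' j :=
  hS.eq_of_edges _ (fun _ _ φ => t.pairing_edge t' φ) hi hj

theorem pairing_comm (t : ThinSummand V S) (t' : ThinSummand V S') (i : X) :
    t.pairing t' i = t'.pairing t i := mul_comm _ _

theorem pairing_eq_zero_of_notMem (t : ThinSummand V S) (t' : ThinSummand V S') {i : X}
    (hi : i ∉ S) : t.pairing t' i = 0 := by
  simp [pairing, t.vec_eq_zero i hi]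

/-- Thin summands with connected supports and a nonzero pairing have the same support. -/
theorem eq_of_pairing_ne_zero (t : ThinSummand V S) (t' : ThinSummand V S') (hS : ConnectedOn S)
    (hS' : ConnectedOn S') {i : X} (h : t.pairing t' i ≠ 0) : S = S' := by
  have hi : i ∈ S := by
    by_contra hi
    exact h (t.pairing_eq_zero_of_notMem t' hi)
  have hi' : i ∈ S' := by
    by_contra hi
    exact h (by rw [pairing_comm]; exact t'.pairing_eq_zero_of_notMem t hi)
  apply Set.Subset.antisymm
  · intro j hj
    by_contra hj'
    apply h
    rw [t.pairing_const t' hS hi hj, pairing_comm, t'.pairing_eq_zero_of_notMem t hj']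
  · intro j hj
    by_contra hj'
    apply h
    rw [pairing_comm, t'.pairing_const t hS' hi' hj, pairing_comm,
      t.pairing_eq_zero_of_notMem t' hj']

/-- If `V` is the sum of two thin representations, these are its only thin summands. -/
theorem eq_or_eq_of_sum {S₁ S₂ : Set X} (t : ThinSummand V S) (t₁ : ThinSummand V S₁)
    (t₂ : ThinSummand V S₂) (hS : ConnectedOn S) (hS₁ : ConnectedOn S₁) (hS₂ : ConnectedOn S₂)
    (h : ∀ i x, x = t₁.fn i x • t₁.vec i + t₂.fn i x • t₂.vec i) : S = S₁ ∨ S = S₂ := by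
  obtain ⟨i, hi⟩ := hS.1
  -- The identity of t factors through the two summands, so the two composites add up to 1 and
  -- cannot both vanish.
  have h1 : t.pairing t₁ i + t.pairing t₂ i = 1 := by
    rw [← t.fn_vec i hi]
    conv_rhs => rw [h i (t.vec i)]
    simp [pairing]
  by_cases h0 : t.pairing t₁ i = 0
  · right
    refine t.eq_of_pairing_ne_zero t₂ hS hS₂ (i := i) ?_
    rw [h0, zero_add] at h1
    simp [h1]
  · exact Or.inl (t.eq_of_pairing_ne_zero t₁ hS hS₁ h0)

/-- A thin representation is its only thin summand. -/
theorem eq_of_eq_smul {S₁ : Set X} (t : ThinSummand V S) (t₁ : ThinSummand V S₁)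
    (hS : ConnectedOn S) (hS₁ : ConnectedOn S₁) (h : ∀ i x, x = t₁.fn i x • t₁.vec i) :
    S = S₁ := by
  obtain ⟨i, hi⟩ := hS.1
  refine t.eq_of_pairing_ne_zero t₁ hS hS₁ (i := i) ?_
  have h1 : t.pairing t₁ i = 1 := by
    rw [← t.fn_vec i hi]
    conv_rhs => rw [h i (t.vec i)]
    simp [pairing]
  rw [h1]
  exact one_ne_zero

/-- A thin summand of a direct summand is a thin summand. -/
def ofSummand {A B : QuiverRep k X} (t : ThinSummand A S)
    (H : ∀ i, V.obj i ≃ₗ[k] (A.directSum B).obj i)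
    (hH : IsHom V (A.directSum B) fun i => (H i : V.obj i →ₗ[k] (A.directSum B).obj i)) :
    ThinSummand V S where
  vec i := (H i).symm (A.inlMap B i (t.vec i))
  fn i := t.fn i ∘ₗ A.fstMap B i ∘ₗ (H i : V.obj i →ₗ[k] (A.directSum B).obj i)
  scal := t.scal
  scal_ne_zero := t.scal_ne_zero
  vec_eq_zero i hi := by rw [t.vec_eq_zero i hi, map_zero, map_zero]
  fn_eq_zero i hi := by rw [t.fn_eq_zero i hi, LinearMap.zero_comp]
  fn_vec i hi := by
    simp only [LinearMap.comp_apply, LinearEquiv.coe_coe, LinearEquiv.apply_symm_apply,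
      fstMap_inlMap, t.fn_vec i hi]
  map_vec {i j} φ hi := by
    apply (H j).injective
    have h1 := LinearMap.congr_fun (hH i j φ) ((H i).symm (A.inlMap B i (t.vec i)))
    simp only [LinearMap.comp_apply, LinearEquiv.coe_coe, LinearEquiv.apply_symm_apply,
      map_inlMap, t.map_vec φ hi] at h1
    rw [← h1, map_smul, map_smul, LinearEquiv.apply_symm_apply]
  fn_map {i j} φ hj x := by
    have h1 := LinearMap.congr_fun (hH i j φ) x
    simp only [LinearMap.comp_apply, LinearEquiv.coe_coe] at h1
    simp only [LinearMap.comp_apply, LinearEquiv.coe_coe]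
    rw [← h1, fstMap_map, t.fn_map φ hj]

end ThinSummand

theorem finrank_directSum (A B : QuiverRep k X) (i : X) :
    Module.finrank k ((A.directSum B).obj i) =
      Module.finrank k (A.obj i) + Module.finrank k (B.obj i) :=
  Module.finrank_prod

end QuiverRep

noncomputable section

/-! ### Nondegenerate subrepresentations of symmetric representations -/

namespace SignedQuiver

variable {Q : SignedQuiver}

theorem dualSign_cast_ne_zero {k : Type u} [Field k] {i j : Q.Double} (φ : i ⟶ j) :
    ((dualSign φ : ℤ) : k) ≠ 0 := by
  unfold dualSign
  split_ifs <;> simp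

end SignedQuiver

namespace QuiverRep

variable {k : Type u} [Field k] {Q : SignedQuiver} {V : QuiverRep k Q.Double}

open SignedQuiver

open Classical in
/-- The sign by which the form changes if its arguments are exchanged. -/
def swapSign (k : Type u) [Field k] (i : Q.Double) : k := if i.star = i then (i.sign : k) else 1

namespace SignedForm

variable (J : SignedForm V)

/-- Puts the two symmetry axioms of a signed form into one formula, so that fixed and paired
vertices need no separate treatment later. -/
theorem form_swap {i j : Q.Double} (h : i.star = j) (h' : j.star = i) (x : V.obj i)
    (y : V.obj j) : J.form j i h' y x = swapSign k i * J.form i j h x y := by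
  by_cases hij : i = j
  · subst hij
    rw [J.form_of_fixed i h, swapSign, if_pos h]
  · rw [J.form_of_ne i j h h' hij, swapSign, if_neg (by rw [h]; exact fun e => hij e.symm), one_mul]

/-- This is the compatibility of J with the dual representation read as adjointness: up to the sign
of the dual, φ and φ* are adjoint. -/
theorem form_map (hJ : IsHom V V.dual J.toDual) {i j : Q.Double} (φ : i ⟶ j) (x : V.obj i)
    (y : V.obj j.star) :
    J.form j j.star rfl (V.map φ x) y =
      ((dualSign φ : ℤ) : k) * J.form i i.star rfl x (V.map (starHom φ) y) := by
  have h1 : dualSign φ • J.form i i.star rfl x (V.map (starHom φ) y) =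
      J.form j j.star rfl (V.map φ x) y :=
    LinearMap.congr_fun (LinearMap.congr_fun (hJ i j φ) x : (_ : Module.Dual k (V.obj j.star)) = _) y
  rw [zsmul_eq_mul] at h1
  exact h1.symm

theorem eq_zero_of_form {i j : Q.Double} (h : i.star = j) {x : V.obj i}
    (hx : ∀ y, J.form i j h x y = 0) : x = 0 :=
  (J.form i j h).map_eq_zero_iff.1 (LinearMap.ext hx)

/-- The form is nondegenerate on the family `N` of subspaces. -/
def NondegenerateOn (N : ∀ i, Submodule k (V.obj i)) : Prop :=
  ∀ (i j : Q.Double) (h : i.star = j), ∀ x ∈ N i, (∀ y ∈ N j, J.form i j h x y = 0) → x = 0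

/-- The orthogonal complements of a family of subspaces. -/
def perp (N : ∀ i, Submodule k (V.obj i)) (i : Q.Double) : Submodule k (V.obj i) where
  carrier := {x | ∀ y ∈ N i.star, J.form i i.star rfl x y = 0}
  add_mem' ha hb y hy := by simp [ha y hy, hb y hy]
  zero_mem' y _ := by simp
  smul_mem' c x hx y hy := by simp [hx y hy]

theorem mem_perp {N : ∀ i, Submodule k (V.obj i)} {i j : Q.Double} (h : i.star = j)
    {x : V.obj i} : x ∈ J.perp N i ↔ ∀ y ∈ N j, J.form i j h x y = 0 := by
  subst h
  rfl

/-- The form restricted to a family of subspaces. -/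
def restrict (N : ∀ i, Submodule k (V.obj i)) (i j : Q.Double) (h : i.star = j) :
    N i →ₗ[k] Module.Dual k (N j) :=
  (N j).subtype.dualMap ∘ₗ (J.form i j h : V.obj i →ₗ[k] _) ∘ₗ (N i).subtype

theorem restrict_apply (N : ∀ i, Submodule k (V.obj i)) (i j : Q.Double) (h : i.star = j)
    (x : N i) (y : N j) : J.restrict N i j h x y = J.form i j h x y := rfl

variable {J} {N : ∀ i, Submodule k (V.obj i)}

theorem NondegenerateOn.restrict_injective (hN : J.NondegenerateOn N) (i j : Q.Double)
    (h : i.star = j) : Function.Injective (J.restrict N i j h) := by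
  rw [← LinearMap.ker_eq_bot, LinearMap.ker_eq_bot']
  intro x hx
  apply Subtype.ext
  refine hN i j h x x.2 fun y hy => ?_
  have := LinearMap.congr_fun hx ⟨y, hy⟩
  rwa [restrict_apply] at this

theorem NondegenerateOn.finrank_le (hN : J.NondegenerateOn N) (i j : Q.Double)
    (h : i.star = j) : Module.finrank k (N i) ≤ Module.finrank k (N j) := by
  rw [← Subspace.dual_finrank_eq (V := N j)]
  exact LinearMap.finrank_le_finrank_of_injective (hN.restrict_injective i j h)

/-- Nondegeneracy is required at every vertex, so the injections at i and at i* bound the two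
dimensions by each other. -/
theorem NondegenerateOn.finrank_eq (hN : J.NondegenerateOn N) (i j : Q.Double)
    (h : i.star = j) : Module.finrank k (N i) = Module.finrank k (Module.Dual k (N j)) := by
  rw [Subspace.dual_finrank_eq]
  exact le_antisymm (hN.finrank_le i j h) (hN.finrank_le j i (by rw [← h, Double.star_star]))

theorem NondegenerateOn.isSymmetric_sub (hJ : IsHom V V.dual J.toDual) (hN : J.NondegenerateOn N)
    (hs : V.IsSubrep N) : (V.sub N hs).IsSymmetric := by
  refine ⟨⟨fun i j h => LinearMap.linearEquivOfInjective (J.restrict N i j h)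
    (hN.restrict_injective i j h) (hN.finrank_eq i j h), ?_, ?_⟩, ?_⟩
  · intro i j h h' hij x y
    exact J.form_of_ne i j h h' hij x.1 y.1
  · intro i h x y
    exact J.form_of_fixed i h x.1 y.1
  · intro i j φ
    refine LinearMap.ext fun x => LinearMap.ext fun y => ?_
    have h1 := J.form_map hJ φ x.1 y.1
    rw [← zsmul_eq_mul] at h1
    exact h1.symm

/-- By adjointness, moving φ to the other argument turns it into φ*, which preserves N. -/
theorem isSubrep_perp (hJ : IsHom V V.dual J.toDual) (hs : V.IsSubrep N) :
    V.IsSubrep (J.perp N) := by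
  intro i j φ x hx y hy
  rw [J.form_map hJ, hx _ (hs _ _ (starHom φ) y hy), mul_zero]

theorem NondegenerateOn.isCompl_perp (hN : J.NondegenerateOn N) (i : Q.Double) :
    IsCompl (N i) (J.perp N i) := by
  refine IsCompl.of_eq ?_ ?_
  · rw [Submodule.eq_bot_iff]
    rintro x ⟨hx, hx'⟩
    exact hN i i.star rfl x hx hx'
  · rw [Submodule.eq_top_iff']
    intro x
    have hsurj := (LinearMap.injective_iff_surjective_of_finrank_eq_finrank
      (hN.finrank_eq i i.star rfl)).1 (hN.restrict_injective i i.star rfl)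
    -- The vector z in N induces the same functional as x on N at i*, so x - z is orthogonal to N.
    obtain ⟨z, hz⟩ := hsurj ((N i.star).subtype.dualMap (J.form i i.star rfl x))
    rw [← add_sub_cancel (z : V.obj i) x]
    refine Submodule.add_mem_sup z.2 fun y hy => ?_
    have := LinearMap.congr_fun hz ⟨y, hy⟩
    rw [restrict_apply] at this
    simp only [map_sub, LinearMap.sub_apply, this]
    exact sub_self _

/-- A vector of the complement that is orthogonal to the complement is orthogonal to N as well,
hence to the whole space. -/
theorem NondegenerateOn.perp (hN : J.NondegenerateOn N) :
    J.NondegenerateOn (J.perp N) := by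
  intro i j h x hx hx'
  have h' : j.star = i := by rw [← h, Double.star_star]
  apply J.eq_zero_of_form h
  intro y
  have hy : y ∈ N j ⊔ J.perp N j := by
    rw [(hN.isCompl_perp j).sup_eq_top]
    trivial
  obtain ⟨a, ha, b, hb, rfl⟩ := Submodule.mem_sup.1 hy
  rw [map_add, (J.mem_perp h).1 hx a ha, hx' b hb, add_zero]

end SignedForm

/-- In an indecomposable symmetric representation a nonzero nondegenerate subrepresentation is
everything. -/
theorem IsIndecomposableSymmetric.eq_top (hV : V.IsIndecomposableSymmetric)
    {J : SignedForm V} (hJ : IsHom V V.dual J.toDual) {N : ∀ i, Submodule k (V.obj i)} (hs : V.IsSubrep N) (hN : J.NondegenerateOn N)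
    {i₀ : Q.Double} (h0 : N i₀ ≠ ⊥) (i : Q.Double) : N i = ⊤ := by
  have hs' := SignedForm.isSubrep_perp hJ hs
  rcases hV.2.2 _ _ (hN.isSymmetric_sub hJ hs) ((hN.perp).isSymmetric_sub hJ hs')
    (V.isomorphic_directSum_sub hs hs' hN.isCompl_perp) with h | h
  · exact absurd (Submodule.subsingleton_iff_eq_bot.1 (h i₀)) h0
  · have := Submodule.subsingleton_iff_eq_bot.1 (h i)
    have h2 := (hN.isCompl_perp i).sup_eq_top
    rwa [this, sup_bot_eq] at h2

/-! ### The dual of a thin summand and the hyperbolic subrepresentation. -/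

namespace ThinSummand

variable {S : Set Q.Double} (J : SignedForm V) (t : ThinSummand V S)

/-- The vectors which represent the functionals of a thin summand. -/
def dualVec (i : Q.Double) : V.obj i := (J.form i i.star rfl).symm (t.fn i.star)

theorem form_dualVec {i j : Q.Double} (h : i.star = j) (y : V.obj j) :
    J.form i j h (t.dualVec J i) y = t.fn j y := by
  subst h
  simp [dualVec]

theorem dualVec_eq_zero {i : Q.Double} (hi : i.star ∉ S) : t.dualVec J i = 0 := by
  rw [dualVec, t.fn_eq_zero _ hi, map_zero]

/-- Nondegeneracy reduces the identity to one between values of the form, where adjointness moves φ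
onto the functional of t. -/
theorem map_dualVec (hJ : IsHom V V.dual J.toDual) {i j : Q.Double} (φ : i ⟶ j)
    (hi : i.star ∈ S) : V.map φ (t.dualVec J i) =
      (((dualSign φ : ℤ) : k) * t.scal (starHom φ)) • t.dualVec J j := by
  rw [← sub_eq_zero]
  apply J.eq_zero_of_form rfl
  intro y
  simp only [map_sub, map_smul, LinearMap.sub_apply, LinearMap.smul_apply, J.form_map hJ,
    form_dualVec, smul_eq_mul, t.fn_map (starHom φ) hi]
  ring

/-- The dual of a thin summand. -/
def dual (hJ : IsHom V V.dual J.toDual) : ThinSummand V (Double.star ⁻¹' S) where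
  vec := t.dualVec J
  fn i := (J.form i i.star rfl : V.obj i →ₗ[k] Module.Dual k (V.obj i.star)).flip (t.vec i.star)
  scal φ := ((dualSign φ : ℤ) : k) * t.scal (starHom φ)
  scal_ne_zero φ := mul_ne_zero (dualSign_cast_ne_zero φ) (t.scal_ne_zero _)
  vec_eq_zero i hi := t.dualVec_eq_zero J hi
  fn_eq_zero i hi := by
    rw [t.vec_eq_zero _ hi, map_zero]
  fn_vec i hi := by
    simp [form_dualVec, t.fn_vec _ hi]
  map_vec φ hi := t.map_dualVec J hJ φ hi
  fn_map {i j} φ hj x := by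
    simp only [LinearMap.flip_apply, LinearEquiv.coe_coe, J.form_map hJ,
      t.map_vec (starHom φ) hj, map_smul, smul_eq_mul]
    ring

/-- Up to sign the pairing is the norm of t times the norm of its dual, so it vanishes as soon as t
is isotropic at one of its vertices. -/
theorem pairing_dual (hJ : IsHom V V.dual J.toDual) {i j : Q.Double} (h : i.star = j)
    (h' : j.star = i) : t.pairing (t.dual J hJ) i =
      J.form i j h (t.vec i) (t.vec j) *
        (swapSign k i * J.form i j h (t.dualVec J i) (t.dualVec J j)) := by
  rw [← J.form_swap h h', form_dualVec]
  subst h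
  rfl

/-- The subspaces spanned by the vectors of a thin summand and of its dual. -/
def hyperbolic (i : Q.Double) : Submodule k (V.obj i) :=
  Submodule.span k {t.vec i, t.dualVec J i}

variable {J t}

theorem isSubrep_hyperbolic (hJ : IsHom V V.dual J.toDual) : V.IsSubrep (t.hyperbolic J) := by
  intro i j φ x hx
  obtain ⟨a, b, rfl⟩ := Submodule.mem_span_pair.1 hx
  rw [map_add, map_smul, map_smul]
  refine add_mem (Submodule.smul_mem _ _ ?_) (Submodule.smul_mem _ _ ?_)
  · by_cases hi : i ∈ S
    · rw [t.map_vec φ hi]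
      exact Submodule.smul_mem _ _ (Submodule.subset_span (by simp))
    · rw [t.vec_eq_zero i hi, map_zero]
      exact zero_mem _
  · by_cases hi : i.star ∈ S
    · rw [t.map_dualVec J hJ φ hi]
      exact Submodule.smul_mem _ _ (Submodule.subset_span (by simp))
    · rw [t.dualVec_eq_zero J hi, map_zero]
      exact zero_mem _

/-- If i and j both lie in S, the Gram matrix of the pairs (vector, dual vector) at i and j has
off-diagonal entries 1 and the swap sign, and the product of its diagonal entries is zero by `hp`.
Its determinant is minus the swap sign, hence nonzero. If only one of i, j lies in S, only one of
the two spanning vectors survives. -/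
theorem coeff_eq_zero (hε : ∀ i : Q.Double, swapSign k i ≠ 0) (hJ : IsHom V V.dual J.toDual)
    (hp : ∀ i, t.pairing (t.dual J hJ) i = 0) {i j : Q.Double} (h : i.star = j) {a b : k}
    (h1 : J.form i j h (a • t.vec i + b • t.dualVec J i) (t.vec j) = 0)
    (h2 : J.form i j h (a • t.vec i + b • t.dualVec J i) (t.dualVec J j) = 0) :
    (i ∈ S → a = 0) ∧ (j ∈ S → b = 0) := by
  have h' : j.star = i := by rw [← h, Double.star_star]
  have hpi := hp i
  rw [t.pairing_dual J hJ h h'] at hpi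
  have hpi := (mul_eq_zero.1 (by linear_combination hpi : swapSign k i *
    (J.form i j h (t.vec i) (t.vec j) * J.form i j h (t.dualVec J i) (t.dualVec J j)) = 0)
    ).resolve_left (hε i)
  have h3 : J.form i j h (t.vec i) (t.dualVec J j) = swapSign k j * t.fn i (t.vec i) := by
    rw [J.form_swap h' h, form_dualVec]
  simp only [map_add, map_smul, LinearMap.add_apply, LinearMap.smul_apply, smul_eq_mul, h3] at h1 h2
  rw [form_dualVec] at h1
  by_cases hi : i ∈ S <;> by_cases hj : j ∈ S
  · rw [t.fn_vec j hj] at h1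
    rw [t.fn_vec i hi] at h2
    have ha : a = 0 := by
      refine (mul_eq_zero.1 (?_ : swapSign k j * a = 0)).resolve_left (hε j)
      -- Elimination of b; the remaining term in a is the product of the two norms, which `hpi`
      -- removes.
      linear_combination h2 - J.form i j h (t.dualVec J i) (t.dualVec J j) * h1 + a * hpi
    refine ⟨fun _ => ha, fun _ => ?_⟩
    rw [ha] at h1
    linear_combination h1
  · refine ⟨fun _ => ?_, fun hj' => absurd hj' hj⟩
    rw [t.fn_vec i hi, t.dualVec_eq_zero J (i := i) (by rwa [h])] at h2
    simp only [map_zero, LinearMap.zero_apply, mul_zero, add_zero, mul_one] at h2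
    exact (mul_eq_zero.1 h2).resolve_right (hε j)
  · refine ⟨fun hi' => absurd hi' hi, fun _ => ?_⟩
    rw [t.fn_vec j hj, t.vec_eq_zero i hi] at h1
    simpa using h1
  · exact ⟨fun hi' => absurd hi' hi, fun hj' => absurd hj' hj⟩

theorem nondegenerateOn_hyperbolic (hε : ∀ i : Q.Double, swapSign k i ≠ 0)
    (hJ : IsHom V V.dual J.toDual) (hp : ∀ i, t.pairing (t.dual J hJ) i = 0) :
    J.NondegenerateOn (t.hyperbolic J) := by
  intro i j h x hx h0
  obtain ⟨a, b, rfl⟩ := Submodule.mem_span_pair.1 hx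
  obtain ⟨ha, hb⟩ := coeff_eq_zero hε hJ hp h (h0 _ (Submodule.subset_span (by simp)))
    (h0 _ (Submodule.subset_span (by simp)))
  have h1 : a • t.vec i = 0 := by
    by_cases hi : i ∈ S
    · rw [ha hi, zero_smul]
    · rw [t.vec_eq_zero i hi, smul_zero]
  have h2 : b • t.dualVec J i = 0 := by
    by_cases hj : j ∈ S
    · rw [hb hj, zero_smul]
    · rw [t.dualVec_eq_zero J (by rwa [h]), smul_zero]
  rw [h1, h2, add_zero]

open Classical in
theorem finrank_hyperbolic (hε : ∀ i : Q.Double, swapSign k i ≠ 0)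
    (hJ : IsHom V V.dual J.toDual) (hp : ∀ i, t.pairing (t.dual J hJ) i = 0) (i : Q.Double) :
    Module.finrank k (t.hyperbolic J i) =
      (if i ∈ S then 1 else 0) + (if i.star ∈ S then 1 else 0) := by
  have hw : i.star ∈ S → t.dualVec J i ≠ 0 := fun hi h => by
    have := t.form_dualVec J rfl (t.vec i.star)
    rw [h, t.fn_vec _ hi] at this
    simp at this
  unfold hyperbolic
  by_cases hi : i ∈ S <;> by_cases hj : i.star ∈ S
  · rw [if_pos hi, if_pos hj]
    -- A vanishing combination is orthogonal to everything, so `coeff_eq_zero` applies to it.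
    have hli : LinearIndependent k ![t.vec i, t.dualVec J i] := by
      rw [LinearIndependent.pair_iff]
      intro a b hab
      obtain ⟨ha, hb⟩ := coeff_eq_zero (t := t) hε hJ hp (i := i) rfl (a := a) (b := b)
        (by rw [hab]; simp) (by rw [hab]; simp)
      exact ⟨ha hi, hb hj⟩
    have := finrank_span_eq_card hli
    rwa [Matrix.range_cons, Matrix.range_cons, Matrix.range_empty, Set.union_empty,
      Set.singleton_union, Fintype.card_fin] at this
  · rw [if_pos hi, if_neg hj, t.dualVec_eq_zero J hj, Set.pair_comm, Submodule.span_insert_zero,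
      finrank_span_singleton (t.vec_ne_zero hi)]
  · rw [if_neg hi, if_pos hj, t.vec_eq_zero i hi, Submodule.span_insert_zero,
      finrank_span_singleton (hw hj)]
  · rw [if_neg hi, if_neg hj, t.dualVec_eq_zero J hj, t.vec_eq_zero i hi,
      Submodule.span_insert_zero, Submodule.span_zero_singleton, finrank_bot]

end ThinSummand

/-! ### Compatible families of vectors and their norms. -/

/-- A compatible family of vectors supported on `S`. -/
def IsThinFamily (V : QuiverRep k Q.Double) (S : Set Q.Double) (v : ∀ i, V.obj i) : Prop :=
  (∀ i, i ∉ S → v i = 0) ∧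
    ∀ (i j : Q.Double) (φ : i ⟶ j), i ∈ S → V.map φ (v i) = v j

theorem IsThinFamily.add {S : Set Q.Double} {v w : ∀ i, V.obj i} (hv : IsThinFamily V S v)
    (hw : IsThinFamily V S w) : IsThinFamily V S (v + w) :=
  ⟨fun i hi => by simp [hv.1 i hi, hw.1 i hi],
    fun i j φ hi => by simp [hv.2 i j φ hi, hw.2 i j φ hi]⟩

/-- Along φ : i → j the vector of v at j is the image of that at i, and φ* carries the vector of w
at j* to that at i*; adjointness with sign 1 equates the two values. -/
theorem IsThinFamily.form_const {S : Set Q.Double} (hS : ConnectedOn S)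
    (hsS : ∀ i, i.star ∈ S ↔ i ∈ S)
    {J : SignedForm V} (hJ : IsHom V V.dual J.toDual)
    (hd : ∀ (i j : Q.Double) (φ : i ⟶ j), dualSign φ = 1) {v w : ∀ i, V.obj i}
    (hv : IsThinFamily V S v) (hw : IsThinFamily V S w) {i j : Q.Double} (hi : i ∈ S)
    (hj : j ∈ S) :
    J.form i i.star rfl (v i) (w i.star) = J.form j j.star rfl (v j) (w j.star) := by
  refine hS.eq_of_edges (fun i => J.form i i.star rfl (v i) (w i.star)) ?_ hi hj
  intro i j φ hi hj
  rw [← hv.2 i j φ hi, J.form_map hJ, hd, hw.2 _ _ (starHom φ) ((hsS j).2 hj)]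
  simp

/-- The spans of a compatible family of vectors of nonzero norm. -/
theorem IsThinFamily.span {S : Set Q.Double} {J : SignedForm V} {v : ∀ i, V.obj i}
    (hv : IsThinFamily V S v) (h0 : ∀ i ∈ S, J.form i i.star rfl (v i) (v i.star) ≠ 0) :
    V.IsSubrep (fun i => Submodule.span k {v i}) ∧
      J.NondegenerateOn (fun i => Submodule.span k {v i}) := by
  constructor
  · intro i j φ x hx
    obtain ⟨a, rfl⟩ := Submodule.mem_span_singleton.1 hx
    rw [map_smul]
    by_cases hi : i ∈ S
    · rw [hv.2 i j φ hi]
      exact Submodule.smul_mem _ _ (Submodule.mem_span_singleton_self _)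
    · rw [hv.1 i hi, map_zero, smul_zero]
      exact zero_mem _
  · rintro i j rfl x hx hx0
    obtain ⟨a, rfl⟩ := Submodule.mem_span_singleton.1 hx
    by_cases hi : i ∈ S
    · have := hx0 _ (Submodule.mem_span_singleton_self _)
      rw [map_smul, LinearMap.smul_apply, smul_eq_mul] at this
      rw [(mul_eq_zero.1 this).resolve_right (h0 i hi), zero_smul]
    · rw [hv.1 i hi, smul_zero]

open Classical in
theorem IsThinFamily.finrank_span {S : Set Q.Double} {J : SignedForm V} {v : ∀ i, V.obj i}
    (hv : IsThinFamily V S v) (h0 : ∀ i ∈ S, J.form i i.star rfl (v i) (v i.star) ≠ 0)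
    (i : Q.Double) : Module.finrank k (Submodule.span k {v i}) = if i ∈ S then 1 else 0 := by
  split_ifs with hi
  · refine finrank_span_singleton fun h => h0 i hi ?_
    rw [h]
    simp
  · rw [hv.1 i hi, Submodule.span_zero_singleton, finrank_bot]

/-- If the form is symmetric and the thin summand is self-dual, there is a compatible family of
vectors of nonzero norm. -/
theorem exists_isThinFamily (hk : (2 : k) ≠ 0) {S : Set Q.Double} (hS : ConnectedOn S)
    (hsS : ∀ i, i.star ∈ S ↔ i ∈ S) {J : SignedForm V} (hJ : IsHom V V.dual J.toDual)
    (hd : ∀ (i j : Q.Double) (φ : i ⟶ j), dualSign φ = 1)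
    (hε : ∀ i : Q.Double, swapSign k i = 1) (t : ThinSummand V S)
    (ht : ∀ (i j : Q.Double) (φ : i ⟶ j), t.scal φ = 1) :
    ∃ v, IsThinFamily V S v ∧ ∀ i ∈ S, J.form i i.star rfl (v i) (v i.star) ≠ 0 := by
  have hv : IsThinFamily V S t.vec :=
    ⟨t.vec_eq_zero, fun i j φ hi => by rw [t.map_vec φ hi, ht, one_smul]⟩
  have hw : IsThinFamily V S (t.dualVec J) :=
    ⟨fun i hi => t.dualVec_eq_zero J (by rwa [hsS]), fun i j φ hi => by
      rw [t.map_dualVec J hJ φ ((hsS i).2 hi), ht, hd]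
      simp⟩
  by_contra! hcon
  obtain ⟨i₀, hi₀⟩ := hS.1
  -- By contradiction every compatible family has norm zero, and constancy lets this be read off at
  -- the single vertex `i₀`.
  have key : ∀ v, IsThinFamily V S v → J.form i₀ i₀.star rfl (v i₀) (v i₀.star) = 0 := by
    intro v hv
    obtain ⟨i, hi, h⟩ := hcon v hv
    rw [hv.form_const hS hsS hJ hd hv hi₀ hi, h]
  have h1 := key _ hv
  have h2 := key _ hw
  have h3 := key _ (hv.add hw)
  have h4 : J.form i₀ i₀.star rfl (t.vec i₀) (t.dualVec J i₀.star) = 1 := by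
    rw [J.form_swap i₀.star_star rfl, hε, one_mul, t.form_dualVec, t.fn_vec _ hi₀]
  have h5 : J.form i₀ i₀.star rfl (t.dualVec J i₀) (t.vec i₀.star) = 1 := by
    rw [t.form_dualVec, t.fn_vec _ ((hsS _).2 hi₀)]
  -- Polarization: the norm of the sum of t and its dual is twice their mutual product 1, so its
  -- vanishing would give 2 = 0.
  simp only [Pi.add_apply, map_add, LinearMap.add_apply, h1, h2, h4, h5] at h3
  exact hk (by linear_combination h3)

end QuiverRep

end

noncomputable section

/-! ### Thin summands of representations of quivers of type `A` -/

/-- The underlying graph of the quiver `X` is a chain of `m` vertices, with positions `pos`. -/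
structure IsChainQuiver (X : Type) [Quiver.{0, 0} X] (m : ℕ) (pos : X → ℕ) : Prop where
  inj : Function.Injective pos
  lt : ∀ x, pos x < m
  surj : ∀ p < m, ∃ x, pos x = p
  adj : ∀ x y : X, (x ⟶ y) → pos y = pos x + 1 ∨ pos x = pos y + 1
  edge : ∀ x y : X, pos y = pos x + 1 →
    (∃ φ : x ⟶ y, (∀ ψ, ψ = φ) ∧ IsEmpty (y ⟶ x)) ∨ (∃ φ : y ⟶ x, (∀ ψ, ψ = φ) ∧ IsEmpty (x ⟶ y))

/-- The vertices with position between `p` and `q`. -/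
def posInterval {X : Type} (pos : X → ℕ) (p q : ℕ) : Set X := {x | p ≤ pos x ∧ pos x ≤ q}

namespace QuiverRep

variable {X : Type} [Quiver.{0, 0} X] {m : ℕ} {pos : X → ℕ}

theorem connectedOn_posInterval (hX : IsChainQuiver X m pos) {p q : ℕ} (hpq : p ≤ q)
    (hq : q < m) : ConnectedOn (posInterval pos p q) := by
  constructor
  · obtain ⟨x, hx⟩ := hX.surj q hq
    exact ⟨x, by rw [hx]; exact hpq, hx.le⟩
  · rintro T hT ⟨a, ha⟩ h
    have step : ∀ x y, pos y = pos x + 1 → x ∈ posInterval pos p q → y ∈ posInterval pos p q →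
        (x ∈ T ↔ y ∈ T) := by
      intro x y hxy hx hy
      rcases hX.edge x y hxy with ⟨φ, -⟩ | ⟨φ, -⟩
      · exact h x y φ hx hy
      · exact (h y x φ hy hx).symm
    have key : ∀ d x y, pos y = pos x + d → x ∈ posInterval pos p q → y ∈ posInterval pos p q →
        (x ∈ T ↔ y ∈ T) := by
      intro d
      induction d with
      | zero =>
        intro x y hxy _ _
        rw [hX.inj hxy]
      | succ d ih =>
        intro x y hxy hx hy
        obtain ⟨z, hz⟩ := hX.surj (pos x + d) (by have := hX.lt y; omega)
        have hz' : z ∈ posInterval pos p q := by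
          constructor <;> have := hx.1 <;> have := hy.2 <;> omega
        exact (ih x z hz hx hz').trans (step z y (by omega) hz' hy)
    refine Set.Subset.antisymm hT fun y hy => ?_
    rcases le_total (pos a) (pos y) with hle | hle
    · exact (key (pos y - pos a) a y (by omega) (hT ha) hy).1 ha
    · exact (key (pos a - pos y) y a (by omega) hy (hT ha)).2 ha

variable {k : Type u} [Field k] (V : QuiverRep k X)

/-- A family of vectors supported on the interval `[p, q]` and compatible with the arrows inside. -/
def VecFamily (pos : X → ℕ) (p q : ℕ) (u : ∀ x, V.obj x) : Prop :=
  (∀ x, x ∉ posInterval pos p q → u x = 0) ∧ ∀ (x y : X) (φ : x ⟶ y),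
    x ∈ posInterval pos p q → y ∈ posInterval pos p q → V.map φ (u x) = u y

/-- A family of functionals supported on the interval `[p, q]` and compatible with the arrows
inside. -/
def FnFamily (pos : X → ℕ) (p q : ℕ) (g : ∀ x, Module.Dual k (V.obj x)) : Prop :=
  (∀ x, x ∉ posInterval pos p q → g x = 0) ∧ ∀ (x y : X) (φ : x ⟶ y),
    x ∈ posInterval pos p q → y ∈ posInterval pos p q → g y ∘ₗ V.map φ = g x

variable {V}

/-- The only arrow inside the longer interval that touches j is the one joining it to i, so only
that arrow has to be checked; `h1` and `h2` cover its two possible orientations. -/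
theorem VecFamily.extend (hX : IsChainQuiver X m pos) {p : ℕ} {i j : X} (hp : p ≤ pos i)
    (hij : pos j = pos i + 1) {u : ∀ x, V.obj x} (hu : VecFamily V pos p (pos i) u) (w : V.obj j)
    (h1 : ∀ φ : i ⟶ j, V.map φ (u i) = w) (h2 : ∀ φ : j ⟶ i, V.map φ w = u i) :
    ∃ u', VecFamily V pos p (pos j) u' ∧ u' j = w := by
  classical
  have hmem : ∀ x, x ≠ j → x ∈ posInterval pos p (pos j) → x ∈ posInterval pos p (pos i) := by
    intro x hx hx'
    have : pos x ≠ pos j := fun e => hx (hX.inj e)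
    exact ⟨hx'.1, by have := hx'.2; omega⟩
  refine ⟨Function.update u j w, ⟨?_, ?_⟩, Function.update_self _ _ _⟩
  · intro x hx
    have hxj : x ≠ j := by
      rintro rfl
      exact hx ⟨by omega, le_rfl⟩
    rw [Function.update_of_ne hxj]
    refine hu.1 x fun h => hx ⟨h.1, h.2.trans (by omega)⟩
  · intro x y φ hx hy
    have hadj := hX.adj x y φ
    by_cases hxj : x = j
    · subst hxj
      have hyx : y ≠ x := by
        rintro rfl
        omega
      have hy' := (hmem y hyx hy).2
      obtain rfl : y = i := hX.inj (by omega)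
      rw [Function.update_self, Function.update_of_ne hyx, h2]
    · rw [Function.update_of_ne hxj]
      by_cases hyj : y = j
      · subst hyj
        have hx' := (hmem x hxj hx).2
        obtain rfl : x = i := hX.inj (by omega)
        rw [Function.update_self, h1]
      · rw [Function.update_of_ne hyj]
        exact hu.2 x y φ (hmem x hxj hx) (hmem y hyj hy)

theorem FnFamily.extend (hX : IsChainQuiver X m pos) {p : ℕ} {i j : X} (hp : p ≤ pos i)
    (hij : pos j = pos i + 1) {g : ∀ x, Module.Dual k (V.obj x)}
    (hg : FnFamily V pos p (pos i) g) (f : Module.Dual k (V.obj j))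
    (h1 : ∀ φ : i ⟶ j, f ∘ₗ V.map φ = g i) (h2 : ∀ φ : j ⟶ i, g i ∘ₗ V.map φ = f) :
    ∃ g', FnFamily V pos p (pos j) g' ∧ g' j = f := by
  classical
  have hmem : ∀ x, x ≠ j → x ∈ posInterval pos p (pos j) → x ∈ posInterval pos p (pos i) := by
    intro x hx hx'
    have : pos x ≠ pos j := fun e => hx (hX.inj e)
    exact ⟨hx'.1, by have := hx'.2; omega⟩
  refine ⟨Function.update g j f, ⟨?_, ?_⟩, Function.update_self _ _ _⟩
  · intro x hx
    have hxj : x ≠ j := by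
      rintro rfl
      exact hx ⟨by omega, le_rfl⟩
    rw [Function.update_of_ne hxj]
    refine hg.1 x fun h => hx ⟨h.1, h.2.trans (by omega)⟩
  · intro x y φ hx hy
    have hadj := hX.adj x y φ
    by_cases hxj : x = j
    · subst hxj
      have hyx : y ≠ x := by
        rintro rfl
        omega
      have hy' := (hmem y hyx hy).2
      obtain rfl : y = i := hX.inj (by omega)
      rw [Function.update_self, Function.update_of_ne hyx, h2]
    · rw [Function.update_of_ne hxj]
      by_cases hyj : y = j
      · subst hyj
        have hx' := (hmem x hxj hx).2
        obtain rfl : x = i := hX.inj (by omega)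
        rw [Function.update_self, h1]
      · rw [Function.update_of_ne hyj]
        exact hg.2 x y φ (hmem x hxj hx) (hmem y hyj hy)

/-- Compatible families of vectors and functionals on an interval give a thin summand if no arrow
leads out of the interval nontrivially. -/
theorem exists_thinSummand_of_families (hX : IsChainQuiver X m pos) {p : ℕ}
    (hz : ∀ x, pos x < p → Subsingleton (V.obj x)) {i : X} (hp : p ≤ pos i)
    {u : ∀ x, V.obj x} {g : ∀ x, Module.Dual k (V.obj x)}
    (hu : VecFamily V pos p (pos i) u) (hg : FnFamily V pos p (pos i) g) (hgu : g i (u i) = 1)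
    (h1 : ∀ j, pos j = pos i + 1 → ∀ φ : i ⟶ j, V.map φ (u i) = 0)
    (h2 : ∀ j, pos j = pos i + 1 → ∀ φ : j ⟶ i, g i ∘ₗ V.map φ = 0) :
    ∃ t : ThinSummand V (posInterval pos p (pos i)),
      ∀ (x y : X) (φ : x ⟶ y), t.scal φ = 1 := by
  refine ⟨⟨u, g, fun _ => 1, fun _ => one_ne_zero, hu.1, hg.1, ?_, ?_, ?_⟩, fun _ _ _ => rfl⟩
  · intro x hx
    rw [← hgu]
    -- The value of the functional on the vector is constant along arrows, so its value 1 at the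
    -- right end spreads over the interval.
    refine (connectedOn_posInterval hX hp (hX.lt i)).eq_of_edges (fun x => g x (u x)) ?_ hx
      ⟨hp, le_rfl⟩
    intro x y φ hx hy
    rw [← hu.2 x y φ hx hy, ← hg.2 x y φ hx hy]
    rfl
  · intro x y φ hx
    rw [one_smul]
    by_cases hy : y ∈ posInterval pos p (pos i)
    · exact hu.2 x y φ hx hy
    · rw [hu.1 y hy]
      have hx1 := hx.1
      have hx2 := hx.2
      have hadj := hX.adj x y φ
      -- An arrow leaving on the left ends in a zero space; one leaving on the right starts at i and
      -- kills the vector by `h1`.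
      rcases lt_or_ge (pos y) p with hlt | hge
      · have := hz y hlt
        exact Subsingleton.elim _ _
      · have hlt : pos i < pos y := by
          by_contra hle
          exact hy ⟨hge, by omega⟩
        obtain rfl : x = i := hX.inj (by omega)
        exact h1 y (by omega) φ
  · intro x y φ hy v
    rw [one_mul]
    by_cases hx : x ∈ posInterval pos p (pos i)
    · rw [← hg.2 x y φ hx hy]
      rfl
    · rw [hg.1 x hx]
      have hy1 := hy.1
      have hy2 := hy.2
      have hadj := hX.adj x y φ
      rcases lt_or_ge (pos x) p with hlt | hge
      · have := hz x hlt
        rw [Subsingleton.elim v 0]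
        simp
      · have hlt : pos i < pos x := by
          by_contra hle
          exact hx ⟨hge, by omega⟩
        obtain rfl : y = i := hX.inj (by omega)
        exact LinearMap.congr_fun (h2 x (by omega) φ) v

/-- There are subspaces `Y ≤ P` at the vertex `i`, `Y ≠ P`, such that the vectors in `P` and the
functionals vanishing on `Y` extend to the interval from `p` to `i`. -/
def Extendable (V : QuiverRep k X) (pos : X → ℕ) (p : ℕ) (i : X) : Prop :=
  ∃ P Y : Submodule k (V.obj i), Y ≤ P ∧ ¬ P ≤ Y ∧
    (∀ v ∈ P, ∃ u, VecFamily V pos p (pos i) u ∧ u i = v) ∧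
    (∀ f : Module.Dual k (V.obj i), (∀ y ∈ Y, f y = 0) →
      ∃ g, FnFamily V pos p (pos i) g ∧ g i = f)

theorem exists_dual_eq_one {W : Type*} [AddCommGroup W] [Module k W] (Y : Submodule k W) {v : W}
    (hv : v ∉ Y) : ∃ f : Module.Dual k W, f v = 1 ∧ ∀ y ∈ Y, f y = 0 := by
  obtain ⟨f, hf, hY⟩ := Submodule.exists_le_ker_of_notMem hv
  refine ⟨(f v)⁻¹ • f, by simp [hf], fun y hy => ?_⟩
  have : f y = 0 := hY hy
  simp [this]

/-- The pair Y < P is carried over the next arrow, by images if it points to the right and by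
preimages if it points to the left. If the new pair is still distinct, the search continues at j; if
it collapses, a thin summand ends at i. -/
theorem Extendable.step (hX : IsChainQuiver X m pos) {p : ℕ}
    (hz : ∀ x, pos x < p → Subsingleton (V.obj x)) {i j : X} (hp : p ≤ pos i)
    (hij : pos j = pos i + 1) (hE : Extendable V pos p i) :
    (∃ t : ThinSummand V (posInterval pos p (pos i)),
      ∀ (x y : X) (φ : x ⟶ y), t.scal φ = 1) ∨ Extendable V pos p j := by
  obtain ⟨P, Y, hYP, hPY, hv, hf⟩ := hE
  rw [SetLike.not_le_iff_exists] at hPY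
  rcases hX.edge i j hij with ⟨φ, hφ, hemp⟩ | ⟨φ, hφ, hemp⟩
  · by_cases hle : P.map (V.map φ) ≤ Y.map (V.map φ)
    · left
      obtain ⟨x, hx, hxY⟩ := hPY
      obtain ⟨y, hy, hyx⟩ := hle (Submodule.mem_map_of_mem hx)
      -- The images of P and Y agree, so P contains a vector outside Y that φ kills: it does not
      -- continue to j.
      have hxyY : x - y ∉ Y := fun h => hxY (by simpa using add_mem h hy)
      obtain ⟨f, hf1, hfY⟩ := exists_dual_eq_one Y hxyY
      obtain ⟨u, hu, hui⟩ := hv _ (sub_mem hx (hYP hy))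
      obtain ⟨g, hg, hgi⟩ := hf f hfY
      refine exists_thinSummand_of_families hX hz hp hu hg (by rw [hui, hgi, hf1]) ?_ ?_
      · intro j' hj' ψ
        obtain rfl : j' = j := hX.inj (by omega)
        rw [hφ ψ, hui, map_sub, hyx, sub_self]
      · intro j' hj' ψ
        obtain rfl : j' = j := hX.inj (by omega)
        exact (hemp.false ψ).elim
    · right
      refine ⟨_, _, Submodule.map_mono hYP, hle, ?_, ?_⟩
      · rintro _ ⟨v, hvP, rfl⟩
        obtain ⟨u, hu, rfl⟩ := hv v hvP
        exact hu.extend hX hp hij _ (fun ψ => by rw [hφ ψ]) (fun ψ => (hemp.false ψ).elim)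
      · intro f hfY
        obtain ⟨g, hg, hgi⟩ := hf (f ∘ₗ V.map φ) fun y hy => hfY _ (Submodule.mem_map_of_mem hy)
        exact hg.extend hX hp hij f (fun ψ => by rw [hφ ψ, hgi]) (fun ψ => (hemp.false ψ).elim)
  · by_cases hle : P.comap (V.map φ) ≤ Y.comap (V.map φ)
    · left
      obtain ⟨x, hx, hxY⟩ := hPY
      -- The preimages of P and Y agree, so x stays independent of Y together with the image of φ. A
      -- functional vanishing on both does not continue to j.
      have hxY' : x ∉ Y ⊔ LinearMap.range (V.map φ) := by
        intro h
        obtain ⟨y, hy, _, ⟨w, rfl⟩, rfl⟩ := Submodule.mem_sup.1 h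
        have hw : V.map φ w ∈ P := by simpa using sub_mem hx (hYP hy)
        exact hxY (add_mem hy (hle hw))
      obtain ⟨f, hf1, hfY⟩ := exists_dual_eq_one _ hxY'
      obtain ⟨u, hu, hui⟩ := hv x hx
      obtain ⟨g, hg, hgi⟩ := hf f fun y hy => hfY y (Submodule.mem_sup_left hy)
      refine exists_thinSummand_of_families hX hz hp hu hg (by rw [hui, hgi, hf1]) ?_ ?_
      · intro j' hj' ψ
        obtain rfl : j' = j := hX.inj (by omega)
        exact (hemp.false ψ).elim
      · intro j' hj' ψ
        obtain rfl : j' = j := hX.inj (by omega)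
        rw [hφ ψ, hgi]
        ext w
        exact hfY _ (Submodule.mem_sup_right ⟨w, rfl⟩)
    · right
      refine ⟨_, _, Submodule.comap_mono hYP, hle, ?_, ?_⟩
      · intro w hw
        obtain ⟨u, hu, hui⟩ := hv (V.map φ w) hw
        exact hu.extend hX hp hij _ (fun ψ => (hemp.false ψ).elim) (fun ψ => by rw [hφ ψ, hui])
      · intro f hfY
        -- The kernel of the map from the space at j to the quotient by Y is the preimage of Y. A
        -- functional vanishing on it is therefore pulled back from that quotient.
        obtain ⟨f', hf', hf'Y⟩ : ∃ f' : Module.Dual k (V.obj i), f' ∘ₗ V.map φ = f ∧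
            ∀ y ∈ Y, f' y = 0 := by
          let T : V.obj j →ₗ[k] V.obj i ⧸ Y := Y.mkQ ∘ₗ V.map φ
          have hT : f ∈ LinearMap.range T.dualMap := by
            rw [LinearMap.range_dualMap_eq_dualAnnihilator_ker, Submodule.mem_dualAnnihilator]
            intro w hw
            refine hfY w ?_
            have : Y.mkQ (V.map φ w) = 0 := hw
            rwa [Submodule.mkQ_apply, Submodule.Quotient.mk_eq_zero] at this
          obtain ⟨l, rfl⟩ := hT
          refine ⟨l ∘ₗ Y.mkQ, rfl, fun y hy => ?_⟩
          rw [LinearMap.comp_apply, Submodule.mkQ_apply, (Submodule.Quotient.mk_eq_zero Y).2 hy,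
            map_zero]
        obtain ⟨g, hg, hgi⟩ := hf f' hf'Y
        exact hg.extend hX hp hij f (fun ψ => (hemp.false ψ).elim) (fun ψ => by rw [hφ ψ, hgi, hf'])

/-- Induction on the number d of vertices to the right of i. At the last vertex nothing lies beyond,
so any vector of P outside Y yields the summand. -/
theorem Extendable.exists_thinSummand (hX : IsChainQuiver X m pos) {p : ℕ}
    (hz : ∀ x, pos x < p → Subsingleton (V.obj x)) : ∀ (d : ℕ) (i : X), p ≤ pos i →
    pos i + d + 1 = m → Extendable V pos p i →
    ∃ q, p ≤ q ∧ q < m ∧ ∃ t : ThinSummand V (posInterval pos p q),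
      ∀ (x y : X) (φ : x ⟶ y), t.scal φ = 1 := by
  intro d
  induction d with
  | zero =>
    intro i hp hd ⟨P, Y, hYP, hPY, hv, hf⟩
    rw [SetLike.not_le_iff_exists] at hPY
    obtain ⟨x, hx, hxY⟩ := hPY
    obtain ⟨f, hf1, hfY⟩ := exists_dual_eq_one _ hxY
    obtain ⟨u, hu, hui⟩ := hv x hx
    obtain ⟨g, hg, hgi⟩ := hf f hfY
    refine ⟨pos i, hp, hX.lt i, exists_thinSummand_of_families hX hz hp hu hg
      (by rw [hui, hgi, hf1]) ?_ ?_⟩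
    · intro j hj
      have := hX.lt j
      omega
    · intro j hj
      have := hX.lt j
      omega
  | succ d ih =>
    intro i hp hd hE
    obtain ⟨j, hj⟩ := hX.surj (pos i + 1) (by omega)
    rcases hE.step hX hz hp hj with h | h
    · exact ⟨pos i, hp, hX.lt i, h⟩
    · exact ih j (by omega) (by omega) h

/-- A nonzero representation of a quiver of type `A` has a thin summand supported on an interval. -/
theorem exists_thinSummand (hX : IsChainQuiver X m pos) (hV : ¬ V.IsZero) :
    ∃ p q, p ≤ q ∧ q < m ∧ ∃ t : ThinSummand V (posInterval pos p q),
      ∀ (x y : X) (φ : x ⟶ y), t.scal φ = 1 := by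
  classical
  have hex : ∃ p, ∃ x, pos x = p ∧ ¬ Subsingleton (V.obj x) := by
    simp only [IsZero, not_forall] at hV
    obtain ⟨x, hx⟩ := hV
    exact ⟨_, x, rfl, hx⟩
  -- The search starts at the leftmost nonzero space, with P everything and Y zero; there are no
  -- arrows inside the one-vertex interval.
  obtain ⟨i, hi, hne⟩ := Nat.find_spec hex
  have hz : ∀ x, pos x < Nat.find hex → Subsingleton (V.obj x) := by
    intro x hx
    by_contra h
    exact Nat.find_min hex hx ⟨x, rfl, h⟩
  refine ⟨Nat.find hex, ?_⟩
  refine Extendable.exists_thinSummand hX hz (m - 1 - pos i) i hi.ge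
    (by have := hX.lt i; omega) ⟨⊤, ⊥, bot_le, ?_, ?_, ?_⟩
  · intro h
    apply hne
    rw [← Submodule.subsingleton_iff k]
    exact subsingleton_of_bot_eq_top (le_bot_iff.1 h).symm
  · intro v _
    rw [hi]
    refine ⟨Pi.single i v, ⟨fun x hx => Pi.single_eq_of_ne ?_ _, ?_⟩, Pi.single_eq_same _ _⟩
    · rintro rfl
      exact hx ⟨hi.ge, hi.le⟩
    · intro x y φ hx hy
      have := hX.adj x y φ
      have h1 := hx.1.antisymm hx.2
      have h2 := hy.1.antisymm hy.2
      omega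
  · intro f _
    rw [hi]
    refine ⟨Pi.single i f, ⟨fun x hx => Pi.single_eq_of_ne ?_ _, ?_⟩, Pi.single_eq_same _ _⟩
    · rintro rfl
      exact hx ⟨hi.ge, hi.le⟩
    · intro x y φ hx hy
      have := hX.adj x y φ
      have h1 := hx.1.antisymm hx.2
      have h2 := hy.1.antisymm hy.2
      omega

end QuiverRep

end

noncomputable section

/-! ### Symmetric representations with prescribed support -/

namespace SignedQuiver

/-- All arrows of `Q̃` are unsigned, and the signed vertices are those fixed by the involution, all
of them of sign `s`. -/
structure HasUniformSign (Q : SignedQuiver) (s : SignType) : Prop where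
  arrow_sign : ∀ a : Q.DoubleArrow, a.sign = 0
  sign_of_fixed : ∀ i : Q.Double, i.star = i → i.sign = s
  sign_of_ne : ∀ i : Q.Double, i.star ≠ i → i.sign = 0

variable {Q : SignedQuiver} {s : SignType} (k : Type u) [Field k]

open Classical in
/-- The sign `-1` at vertices of sign `-1`, and `1` otherwise. -/
def vertexSign (i : Q.Double) : k := if i.sign = -1 then -1 else 1

theorem vertexSign_mul_self (i : Q.Double) : vertexSign k i * vertexSign k i = 1 := by
  unfold vertexSign
  split_ifs <;> ring

theorem vertexSign_ne_zero (i : Q.Double) : vertexSign k i ≠ 0 := by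
  unfold vertexSign
  split_ifs <;> simp

namespace HasUniformSign

variable {k} (hQ : Q.HasUniformSign s)

include hQ

theorem dualSign_eq {i j : Q.Double} (φ : i ⟶ j) :
    ((dualSign φ : ℤ) : k) = vertexSign k j := by
  unfold dualSign vertexSign
  rw [hQ.arrow_sign]
  by_cases h : j.sign = -1 <;> simp [h]

theorem vertexSign_star (i : Q.Double) : vertexSign k i.star = vertexSign k i := by
  by_cases h : i.star = i
  · rw [h]
  · unfold vertexSign
    rw [hQ.sign_of_ne i h, hQ.sign_of_ne i.star (by rw [Double.star_star]; exact fun e => h e.symm)]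

theorem swapSign_eq (hs : s ≠ 0) (i : Q.Double) :
    QuiverRep.swapSign k i = vertexSign k i := by
  unfold QuiverRep.swapSign vertexSign
  by_cases h : i.star = i
  · rw [if_pos h, hQ.sign_of_fixed i h]
    rcases s with _ | _ | _
    · exact absurd rfl hs
    · simp
    · simp
  · rw [if_neg h, hQ.sign_of_ne i h]
    simp

theorem swapSign_ne_zero (hs : s ≠ 0) (i : Q.Double) : QuiverRep.swapSign k i ≠ 0 := by
  rw [hQ.swapSign_eq hs]
  exact vertexSign_ne_zero k i

theorem vertexSign_eq_one (hs : s = 1) (i : Q.Double) : vertexSign k i = 1 := by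
  unfold vertexSign
  rw [if_neg]
  by_cases h : i.star = i
  · rw [hQ.sign_of_fixed i h, hs]
    decide
  · rw [hQ.sign_of_ne i h]
    decide

theorem dualSign_eq_one (hs : s = 1) {i j : Q.Double} (φ : i ⟶ j) : dualSign φ = 1 := by
  have : j.sign ≠ -1 := by
    by_cases h : j.star = j
    · rw [hQ.sign_of_fixed j h, hs]
      decide
    · rw [hQ.sign_of_ne j h]
      decide
  unfold dualSign
  rw [hQ.arrow_sign, if_neg]
  simp [this]

end HasUniformSign

end SignedQuiver

/-! ### Explicit symmetric representations built from lines. -/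

namespace QuiverRep

open SignedQuiver

variable (k : Type u) [Field k]

/-- The field `k` if `P` holds, and zero otherwise. -/
def line (P : Prop) : Submodule k k where
  carrier := {x | ¬ P → x = 0}
  add_mem' ha hb h := by rw [ha h, hb h, add_zero]
  zero_mem' _ := rfl
  smul_mem' c x hx h := by rw [hx h, smul_zero]

open Classical in
theorem finrank_line (P : Prop) : Module.finrank k (line k P) = if P then 1 else 0 := by
  split_ifs with h
  · have : line k P = ⊤ := by
      rw [Submodule.eq_top_iff']
      exact fun x hx => absurd h hx
    rw [this, finrank_top, Module.finrank_self]
  · have : line k P = ⊥ := by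
      rw [Submodule.eq_bot_iff]
      exact fun x hx => hx h
    rw [this, finrank_bot]

open Classical in
/-- Multiplication by `c`, between two lines. -/
def lineMap (P P' : Prop) (c : k) : line k P →ₗ[k] line k P' where
  toFun x := ⟨if P' then c * x else 0, fun h => if_neg h⟩
  map_add' x y := by
    apply Subtype.ext
    by_cases h : P' <;> simp [h, mul_add]
  map_smul' a x := by
    apply Subtype.ext
    by_cases h : P' <;> simp [h, mul_left_comm]

open Classical in
/-- The unit vector of a line, if it is not zero. -/
def unit (P : Prop) : line k P := ⟨if P then 1 else 0, fun h => if_neg h⟩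

variable {k}

theorem line_eq_zero {P : Prop} (h : ¬ P) (x : line k P) : (x : k) = 0 := x.2 h

theorem lineMap_of_pos {P P' : Prop} (h : P') (c : k) (x : line k P) :
    (lineMap k P P' c x : k) = c * x := if_pos h

theorem unit_of_pos {P : Prop} (h : P) : (unit k P : k) = 1 := if_pos h

theorem unit_of_neg {P : Prop} (h : ¬ P) : unit k P = 0 := Subtype.ext (if_neg h)

theorem lineMap_unit {P P' : Prop} (h : P) (c : k) :
    lineMap k P P' c (unit k P) = c • unit k P' := by
  apply Subtype.ext
  by_cases h' : P'
  · rw [lineMap_of_pos h', unit_of_pos h]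
    simp [unit_of_pos h']
  · rw [unit_of_neg h', smul_zero]
    exact line_eq_zero h' _

theorem eq_smul_unit {P : Prop} (x : line k P) : x = (x : k) • unit k P := by
  apply Subtype.ext
  by_cases h : P
  · simp [unit_of_pos h]
  · rw [line_eq_zero h x, zero_smul]
    rfl

/-- A nondegenerate pairing of finite-dimensional spaces induces an isomorphism. -/
def equivOfPairing {A B : Type*} [AddCommGroup A] [Module k A] [Module.Finite k A]
    [AddCommGroup B] [Module k B] [Module.Finite k B] (f : A →ₗ[k] Module.Dual k B)
    (h : ∀ x, (∀ y, f x y = 0) → x = 0) (h' : ∀ y, (∀ x, f x y = 0) → y = 0) :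
    A ≃ₗ[k] Module.Dual k B :=
  have h1 : Function.Injective f := by
    rw [← LinearMap.ker_eq_bot, LinearMap.ker_eq_bot']
    exact fun x hx => h x fun y => by rw [hx]; rfl
  have h2 : Function.Injective f.flip := by
    rw [← LinearMap.ker_eq_bot, LinearMap.ker_eq_bot']
    exact fun y hy => h' y fun x => LinearMap.congr_fun hy x
  LinearMap.linearEquivOfInjective f h1 (by
    have e1 := LinearMap.finrank_le_finrank_of_injective h1
    have e2 := LinearMap.finrank_le_finrank_of_injective h2
    rw [Subspace.dual_finrank_eq] at e1 e2 ⊢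
    exact le_antisymm e1 e2)

variable (k) {Q : SignedQuiver} (S : Set Q.Double)

/-- The thin representation with support `S`. -/
def thin : QuiverRep k Q.Double where
  obj i := line k (i ∈ S)
  map {i j} _ := lineMap k (i ∈ S) (j ∈ S) 1

/-- The sum of the thin representation with support `S` and its dual. -/
def thinDouble : QuiverRep k Q.Double where
  obj i := line k (i ∈ S) × line k (i.star ∈ S)
  map {i j} _ := (lineMap k (i ∈ S) (j ∈ S) 1).prodMap
    -- Using the sign of the tail makes `doublePairing` a morphism: φ* : j* → i* then carries the
    -- sign of j* on this summand, which cancels the sign of j in the dual.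
    (lineMap k (i.star ∈ S) (j.star ∈ S) (vertexSign k i))

open Classical in
theorem finrank_thin (i : Q.Double) :
    Module.finrank k ((thin k S).obj i) = if i ∈ S then 1 else 0 := finrank_line k _

open Classical in
theorem finrank_thinDouble (i : Q.Double) : Module.finrank k ((thinDouble k S).obj i) =
    (if i ∈ S then 1 else 0) + (if i.star ∈ S then 1 else 0) := by
  have := Module.finrank_prod (R := k) (M := line k (i ∈ S)) (M' := line k (i.star ∈ S))
  rw [finrank_line, finrank_line] at this
  exact this

/-- The tautological thin summand of a thin representation. -/
def thinSummandThin : ThinSummand (thin k S) S where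
  vec i := unit k (i ∈ S)
  fn i := (line k (i ∈ S)).subtype
  scal _ := 1
  scal_ne_zero _ := one_ne_zero
  vec_eq_zero _ hi := unit_of_neg hi
  fn_eq_zero _ hi := LinearMap.ext fun x => line_eq_zero hi x
  fn_vec _ hi := unit_of_pos hi
  map_vec _ hi := lineMap_unit hi 1
  fn_map _ hj x := lineMap_of_pos hj 1 x

/-- The first thin summand of `thinDouble`. -/
def thinSummandFst : ThinSummand (thinDouble k S) S where
  vec i := (unit k (i ∈ S), 0)
  fn i := (line k (i ∈ S)).subtype ∘ₗ LinearMap.fst k (line k (i ∈ S)) (line k (i.star ∈ S))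
  scal _ := 1
  scal_ne_zero _ := one_ne_zero
  vec_eq_zero _ hi := Prod.ext (unit_of_neg hi) rfl
  fn_eq_zero _ hi := LinearMap.ext fun _ => line_eq_zero hi _
  fn_vec _ hi := unit_of_pos hi
  map_vec {i j} _ hi := Prod.ext (lineMap_unit hi 1)
    ((map_zero (lineMap k (i.star ∈ S) (j.star ∈ S) (vertexSign k i))).trans (smul_zero _).symm)
  fn_map _ hj x := lineMap_of_pos hj 1 x.1

/-- The second thin summand of `thinDouble`. -/
def thinSummandSnd : ThinSummand (thinDouble k S) (Double.star ⁻¹' S) where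
  vec i := (0, unit k (i.star ∈ S))
  fn i := (line k (i.star ∈ S)).subtype ∘ₗ
    LinearMap.snd k (line k (i ∈ S)) (line k (i.star ∈ S))
  scal {i _} _ := vertexSign k i
  scal_ne_zero {i _} _ := vertexSign_ne_zero k i
  vec_eq_zero _ hi := Prod.ext rfl (unit_of_neg hi)
  fn_eq_zero _ hi := LinearMap.ext fun _ => line_eq_zero hi _
  fn_vec _ hi := unit_of_pos hi
  map_vec {i j} _ hi := Prod.ext
    ((map_zero (lineMap k (i ∈ S) (j ∈ S) 1)).trans (smul_zero _).symm) (lineMap_unit hi _)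
  fn_map {i _} _ hj x := lineMap_of_pos hj (vertexSign k i) x.2

variable {S}

theorem eq_thinSummandThin (i : Q.Double) (x : (thin k S).obj i) :
    x = (thinSummandThin k S).fn i x • (thinSummandThin k S).vec i := eq_smul_unit x

theorem eq_thinSummand_add (i : Q.Double) (x : (thinDouble k S).obj i) :
    x = (thinSummandFst k S).fn i x • (thinSummandFst k S).vec i +
      (thinSummandSnd k S).fn i x • (thinSummandSnd k S).vec i := by
  refine Prod.ext ?_ ?_
  · exact (eq_smul_unit x.1).trans ((congrArg _ (smul_zero _)).trans (add_zero _)).symm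
  · exact (eq_smul_unit x.2).trans ((congrArg (· + _) (smul_zero _)).trans (zero_add _)).symm

variable (S)

/-- The multiplication pairing of two lines. -/
def lineMul (P P' : Prop) : line k P →ₗ[k] line k P' →ₗ[k] k :=
  (LinearMap.mul k k).domRestrict₁₂ (line k P) (line k P')

variable {k} in
theorem lineMul_apply (P P' : Prop) (x : line k P) (y : line k P') :
    lineMul k P P' x y = x * y := rfl

/-- The pairing of the spaces of `thinDouble` at opposite vertices. -/
def doublePairing (i j : Q.Double) : (line k (i ∈ S) × line k (i.star ∈ S)) →ₗ[k]
    Module.Dual k (line k (j ∈ S) × line k (j.star ∈ S)) :=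
  (lineMul k (i ∈ S) (j.star ∈ S)).compl₁₂ (LinearMap.fst k _ _) (LinearMap.snd k _ _) +
    vertexSign k i •
      (lineMul k (i.star ∈ S) (j ∈ S)).compl₁₂ (LinearMap.snd k _ _) (LinearMap.fst k _ _)

theorem doublePairing_apply (i j : Q.Double) (x : line k (i ∈ S) × line k (i.star ∈ S))
    (y : line k (j ∈ S) × line k (j.star ∈ S)) : doublePairing k S i j x y =
      x.1 * y.2 + vertexSign k i * (x.2 * y.1) := rfl

variable {k S}

theorem doublePairing_left {i j : Q.Double} (h : i.star = j)
    (x : line k (i ∈ S) × line k (i.star ∈ S)) (hx : ∀ y, doublePairing k S i j x y = 0) :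
    x = 0 := by
  subst h
  have h1 := hx (0, unit k _)
  have h2 := hx (unit k _, 0)
  rw [doublePairing_apply] at h1 h2
  refine Prod.ext (Subtype.ext ?_) (Subtype.ext ?_)
  · by_cases hi : i ∈ S
    · rw [unit_of_pos (by rwa [Double.star_star])] at h1
      simpa using h1
    · exact line_eq_zero hi _
  · by_cases hi : i.star ∈ S
    · rw [unit_of_pos hi] at h2
      simpa [vertexSign_ne_zero] using h2
    · exact line_eq_zero hi _

theorem doublePairing_right {i j : Q.Double} (h : i.star = j)
    (y : line k (j ∈ S) × line k (j.star ∈ S)) (hy : ∀ x, doublePairing k S i j x y = 0) :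
    y = 0 := by
  subst h
  have h1 := hy (0, unit k _)
  have h2 := hy (unit k _, 0)
  rw [doublePairing_apply] at h1 h2
  refine Prod.ext (Subtype.ext ?_) (Subtype.ext ?_)
  · by_cases hi : i.star ∈ S
    · rw [unit_of_pos hi] at h1
      simpa [vertexSign_ne_zero] using h1
    · exact line_eq_zero hi _
  · by_cases hi : i ∈ S
    · rw [unit_of_pos hi] at h2
      simpa using h2
    · exact line_eq_zero (by rwa [Double.star_star]) _

/-- The two terms of the pairing agree separately. In the first the signs of j and j* multiply to 1;
in the second the sign of j is common to both sides. If a line is zero, both terms vanish. -/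
theorem doublePairing_map {s : SignType} (hQ : Q.HasUniformSign s) (i j : Q.Double)
    (x : line k (i ∈ S) × line k (i.star ∈ S))
    (y : line k (j.star ∈ S) × line k (j.star.star ∈ S)) :
    vertexSign k j * doublePairing k S i i.star x
        (lineMap k (j.star ∈ S) (i.star ∈ S) 1 y.1,
          lineMap k (j.star.star ∈ S) (i.star.star ∈ S) (vertexSign k j.star) y.2) =
      doublePairing k S j j.star (lineMap k (i ∈ S) (j ∈ S) 1 x.1,
        lineMap k (i.star ∈ S) (j.star ∈ S) (vertexSign k i) x.2) y := by
  rw [doublePairing_apply, doublePairing_apply]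
  have e1 : vertexSign k j * (x.1 * (lineMap k (j.star.star ∈ S) (i.star.star ∈ S)
      (vertexSign k j.star) y.2 : k)) = (lineMap k (i ∈ S) (j ∈ S) 1 x.1 : k) * y.2 := by
    by_cases hi : i ∈ S
    · by_cases hj : j ∈ S
      · rw [lineMap_of_pos hj, lineMap_of_pos (by rwa [Double.star_star]), hQ.vertexSign_star]
        linear_combination (x.1 * y.2 : k) * vertexSign_mul_self k j
      · rw [line_eq_zero (P := j ∈ S) hj,
          lineMap_of_pos (P' := i.star.star ∈ S) (by rwa [Double.star_star]),
          line_eq_zero (P := j.star.star ∈ S) (by rwa [Double.star_star])]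
        ring
    · rw [line_eq_zero (P := i ∈ S) hi]
      by_cases hj : j ∈ S
      · rw [lineMap_of_pos hj, line_eq_zero (P := i ∈ S) hi]
        ring
      · rw [line_eq_zero (P := j ∈ S) hj]
        ring
  have e2 : (x.2 * (lineMap k (j.star ∈ S) (i.star ∈ S) 1 y.1 : k)) * vertexSign k i =
      (lineMap k (i.star ∈ S) (j.star ∈ S) (vertexSign k i) x.2 : k) * y.1 := by
    by_cases hi : i.star ∈ S
    · by_cases hj : j.star ∈ S
      · rw [lineMap_of_pos hj, lineMap_of_pos hi]
        ring
      · rw [line_eq_zero (P := j.star ∈ S) hj, lineMap_of_pos hi,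
          line_eq_zero (P := j.star ∈ S) hj]
        ring
    · rw [line_eq_zero hi x.2]
      by_cases hj : j.star ∈ S
      · rw [lineMap_of_pos hj, line_eq_zero hi x.2]
        ring
      · rw [line_eq_zero (P := j.star ∈ S) hj]
        ring
  linear_combination e1 + vertexSign k j * e2

theorem isSymmetric_thinDouble {s : SignType} (hQ : Q.HasUniformSign s) (hs : s ≠ 0)
    (S : Set Q.Double) : (thinDouble k S).IsSymmetric := by
  refine ⟨⟨fun i j h => equivOfPairing (doublePairing k S i j) (doublePairing_left h)
    (doublePairing_right h), ?_, ?_⟩, ?_⟩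
  · intro i j h h' hij x y
    have h1 : i.star ≠ i := fun e => hij (e.symm.trans h)
    have h2 : j.star ≠ j := fun e => hij (h'.symm.trans e)
    have e1 := doublePairing_apply k S j i y x
    have e2 := doublePairing_apply k S i j x y
    rw [vertexSign, hQ.sign_of_ne _ h2, if_neg (by decide)] at e1
    rw [vertexSign, hQ.sign_of_ne _ h1, if_neg (by decide)] at e2
    refine e1.trans (Eq.trans ?_ e2.symm)
    ring
  · intro i h x y
    -- At a fixed vertex exchanging the arguments interchanges the two terms. As the sign squares to
    -- 1, this multiplies the pairing by that sign.
    have h1 := hQ.swapSign_eq (k := k) hs i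
    rw [swapSign, if_pos h] at h1
    refine (doublePairing_apply k S i i y x).trans
      (Eq.trans ?_ (congrArg _ (doublePairing_apply k S i i x y)).symm)
    rw [h1]
    linear_combination (-(x.2 * y.1 : k)) * vertexSign_mul_self k i
  · intro i j φ
    refine LinearMap.ext fun x => LinearMap.ext fun y => ?_
    have h1 := doublePairing_map hQ i j x y
    rw [← hQ.dualSign_eq φ, ← zsmul_eq_mul] at h1
    exact h1

theorem lineMul_left {P P' : Prop} (h : P' ↔ P) (x : line k P)
    (hx : ∀ y, lineMul k P P' x y = 0) : x = 0 := by
  have h1 := hx (unit k _)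
  apply Subtype.ext
  by_cases hi : P
  · rw [lineMul_apply, unit_of_pos (h.2 hi)] at h1
    simpa using h1
  · exact line_eq_zero hi _

theorem lineMul_right {P P' : Prop} (h : P' ↔ P) (y : line k P')
    (hy : ∀ x, lineMul k P P' x y = 0) : y = 0 := by
  have h1 := hy (unit k _)
  apply Subtype.ext
  by_cases hi : P
  · rw [lineMul_apply, unit_of_pos hi] at h1
    simpa using h1
  · exact line_eq_zero (fun hj => hi (h.1 hj)) _

theorem lineMul_lineMap {P P' T T' : Prop} (h : P' ↔ P) (h' : T' ↔ T) (x : line k P)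
    (y : line k T') : lineMul k P P' x (lineMap k T' P' 1 y) =
      lineMul k T T' (lineMap k P T 1 x) y := by
  rw [lineMul_apply, lineMul_apply]
  by_cases hi : P
  · by_cases hj : T
    · rw [lineMap_of_pos hj, lineMap_of_pos (h.2 hi)]
      ring
    · rw [line_eq_zero (P := T) hj, lineMap_of_pos (h.2 hi),
        line_eq_zero (P := T') (fun h => hj (h'.1 h))]
      ring
  · rw [line_eq_zero (P := P) hi]
    by_cases hj : T
    · rw [lineMap_of_pos hj, line_eq_zero (P := P) hi]
      ring
    · rw [line_eq_zero (P := T) hj]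
      ring

/-- For s = 1 no signs occur at all, and multiplication of scalars is a symmetric form pairing the
lines at i and i*. -/
theorem isSymmetric_thin {s : SignType} (hQ : Q.HasUniformSign s) (hs : s = 1)
    (hS : ∀ i, i.star ∈ S ↔ i ∈ S) : (thin k S).IsSymmetric := by
  have hstar : ∀ {i j : Q.Double}, i.star = j → (j ∈ S ↔ i ∈ S) := by
    rintro i _ rfl
    exact hS i
  refine ⟨⟨fun i j h => equivOfPairing (lineMul k (i ∈ S) (j ∈ S)) (lineMul_left (hstar h))
    (lineMul_right (hstar h)), ?_, ?_⟩, ?_⟩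
  · intro i j h h' hij x y
    exact mul_comm _ _
  · intro i h x y
    have h1 : (i.sign : k) = 1 := by simp [hQ.sign_of_fixed i h, hs]
    rw [h1, one_mul]
    exact mul_comm _ _
  · intro i j φ
    refine LinearMap.ext fun x => LinearMap.ext fun y => ?_
    have h1 := lineMul_lineMap (hS i) (hS j) x y
    rw [← one_smul ℤ (lineMul k (i ∈ S) (i.star ∈ S) x _), ← hQ.dualSign_eq_one hs φ] at h1
    exact h1

end QuiverRep

end

noncomputable section

/-! ### Indecomposable symmetric representations of symmetric chains -/

namespace SignedQuiver

/-- `Q̃` is a chain of `m` vertices, `m` odd, reversed by the involution, without signed arrows, and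
with middle vertex of sign `s`. -/
structure IsSymmetricChain (Q : SignedQuiver) (m : ℕ) (pos : Q.Double → ℕ) (s : SignType) :
    Prop where
  uniform : Q.HasUniformSign s
  chain : IsChainQuiver Q.Double m pos
  pos_star : ∀ i, pos i.star + pos i + 1 = m
  odd : Odd m

variable {Q : SignedQuiver} {m : ℕ} {pos : Q.Double → ℕ} {s : SignType}

theorem IsSymmetricChain.star_mem (hQ : Q.IsSymmetricChain m pos s) {p q : ℕ} (hpq : p ≤ q)
    (hq : q < m) (i : Q.Double) :
    i.star ∈ posInterval pos p q ↔ i ∈ posInterval pos (m - 1 - q) (m - 1 - p) := by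
  have := hQ.pos_star i
  simp only [posInterval, Set.mem_ofPred_eq]
  omega

theorem IsSymmetricChain.connectedOn_star (hQ : Q.IsSymmetricChain m pos s) {p q : ℕ}
    (hpq : p ≤ q) (hq : q < m) :
    QuiverRep.ConnectedOn (Double.star ⁻¹' posInterval pos p q) := by
  have : Double.star ⁻¹' posInterval pos p q = posInterval pos (m - 1 - q) (m - 1 - p) :=
    Set.ext (hQ.star_mem hpq hq)
  rw [this]
  exact QuiverRep.connectedOn_posInterval hQ.chain (by omega) (by omega)

/-- A self-dual interval contains the mirror images of its ends, hence is centred at (m - 1)/2. As m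
is odd, a vertex sits there. -/
theorem IsSymmetricChain.exists_fixed (hQ : Q.IsSymmetricChain m pos s) {p q : ℕ} (hpq : p ≤ q)
    (hq : q < m) (h : ∀ i : Q.Double, i.star ∈ posInterval pos p q ↔ i ∈ posInterval pos p q) :
    ∃ i : Q.Double, i.star = i ∧ i ∈ posInterval pos p q := by
  obtain ⟨c, hc⟩ := hQ.odd
  obtain ⟨i, hi⟩ := hQ.chain.surj c (by omega)
  obtain ⟨x, hx⟩ := hQ.chain.surj p (by omega)
  have h1 := (h x).2 ⟨hx.ge, by omega⟩
  have h2 := h1.2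
  have h3 := hQ.pos_star x
  obtain ⟨y, hy⟩ := hQ.chain.surj q (by omega)
  have h4 := ((h y).2 ⟨by omega, hy.le⟩).1
  have h5 := hQ.pos_star y
  have h6 := hQ.pos_star i
  exact ⟨i, hQ.chain.inj (by omega), by omega, by omega⟩

open Classical in
/-- The dimension vector of the indecomposable symmetric representation attached to the thin
representation with support `S`. -/
def rootDim (s : SignType) (S : Set Q.Double) (i : Q.Double) : ℕ :=
  if s = 1 ∧ ∀ j : Q.Double, j.star ∈ S ↔ j ∈ S then (if i ∈ S then 1 else 0)
  else (if i ∈ S then 1 else 0) + (if i.star ∈ S then 1 else 0)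

open Classical in
theorem rootDim_star (s : SignType) (S : Set Q.Double) :
    rootDim s (Double.star ⁻¹' S) = rootDim s S := by
  funext i
  have h : (∀ j : Q.Double, j.star ∈ Double.star ⁻¹' S ↔ j ∈ Double.star ⁻¹' S) ↔
      ∀ j : Q.Double, j.star ∈ S ↔ j ∈ S := by
    simp only [Set.mem_preimage, Double.star_star]
    exact forall_congr' fun j => Iff.comm
  have h2 : i ∈ Double.star ⁻¹' S ↔ i.star ∈ S := Iff.rfl
  have h3 : i.star ∈ Double.star ⁻¹' S ↔ i ∈ S := by rw [Set.mem_preimage, Double.star_star]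
  unfold rootDim
  by_cases hs : s = 1 ∧ ∀ j : Q.Double, j.star ∈ S ↔ j ∈ S
  · have hs' := And.intro hs.1 (h.2 hs.2)
    rw [if_pos hs, if_pos hs']
    exact if_congr (h2.trans (hs.2 i)) rfl rfl
  · have hs' := fun e : s = 1 ∧ ∀ j : Q.Double, j.star ∈ Double.star ⁻¹' S ↔
      j ∈ Double.star ⁻¹' S => hs ⟨e.1, h.1 e.2⟩
    rw [if_neg hs, if_neg hs', add_comm]
    exact congrArg₂ _ (if_congr h3 rfl rfl) (if_congr h2 rfl rfl)

theorem rootDim_ne_zero (s : SignType) {S : Set Q.Double} {i : Q.Double} (hi : i ∈ S) :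
    rootDim s S i ≠ 0 := by
  unfold rootDim
  rw [if_pos hi]
  split_ifs <;> simp

end SignedQuiver

namespace QuiverRep

open SignedQuiver

variable {k : Type u} [Field k] {Q : SignedQuiver} {m : ℕ} {pos : Q.Double → ℕ} {s : SignType}

/-- A nonzero symmetric representation has a thin summand which generates, together with its dual,
a nondegenerate subrepresentation. -/
theorem exists_nondegenerateOn (hk : (2 : k) ≠ 0) (hQ : Q.IsSymmetricChain m pos s) (hs : s ≠ 0)
    {A : QuiverRep k Q.Double} (hA : ¬ A.IsZero) {J : SignedForm A}
    (hJ : IsHom A A.dual J.toDual) :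
    ∃ p q, p ≤ q ∧ q < m ∧ Nonempty (ThinSummand A (posInterval pos p q)) ∧
      ∃ N, A.IsSubrep N ∧ J.NondegenerateOn N ∧
        ∀ i, Module.finrank k (N i) = rootDim s (posInterval pos p q) i := by
  obtain ⟨p, q, hpq, hq, t, ht⟩ := exists_thinSummand hQ.chain hA
  refine ⟨p, q, hpq, hq, ⟨t⟩, ?_⟩
  have hS := connectedOn_posInterval hQ.chain hpq hq
  have hε := hQ.uniform.swapSign_ne_zero (k := k) hs
  -- Whenever t pairs to zero with its dual, the hyperbolic span has the required properties. This
  -- serves both remaining cases.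
  have hyp : (∀ i, t.pairing (t.dual J hJ) i = 0) →
      ¬ (s = 1 ∧ ∀ j : Q.Double, j.star ∈ posInterval pos p q ↔ j ∈ posInterval pos p q) →
      ∃ N, A.IsSubrep N ∧ J.NondegenerateOn N ∧
        ∀ i, Module.finrank k (N i) = rootDim s (posInterval pos p q) i := by
    intro hp hn
    refine ⟨_, ThinSummand.isSubrep_hyperbolic hJ,
      ThinSummand.nondegenerateOn_hyperbolic hε hJ hp, fun i => ?_⟩
    rw [ThinSummand.finrank_hyperbolic hε hJ hp, rootDim, if_neg hn]
  by_cases hsd : ∀ j : Q.Double, j.star ∈ posInterval pos p q ↔ j ∈ posInterval pos p q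
  · by_cases hs1 : s = 1
    · obtain ⟨v, hv, h0⟩ := exists_isThinFamily hk hS hsd hJ
        (fun i j φ => hQ.uniform.dualSign_eq_one hs1 φ)
        (fun i => by rw [hQ.uniform.swapSign_eq hs, hQ.uniform.vertexSign_eq_one hs1]) t ht
      refine ⟨_, (hv.span h0).1, (hv.span h0).2, fun i => ?_⟩
      have hc := And.intro hs1 hsd
      rw [hv.finrank_span h0, rootDim, if_pos hc]
    · refine hyp ?_ fun h => hs1 h.1
      have hs2 : s = -1 := by
        rcases s with _ | _ | _
        · exact absurd rfl hs
        · rfl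
        · exact absurd rfl hs1
      obtain ⟨c, hc, hcS⟩ := hQ.exists_fixed hpq hq hsd
      have h0 : t.pairing (t.dual J hJ) c = 0 := by
        rw [t.pairing_dual J hJ hc hc]
        have h1 := J.form_of_fixed c hc (t.vec c) (t.vec c)
        rw [hQ.uniform.sign_of_fixed c hc, hs2] at h1
        -- At the fixed vertex the form is antisymmetric, hence alternating as 2 ≠ 0. So t is
        -- isotropic there, and constancy makes the pairing vanish everywhere.
        have h2 : (2 : k) * J.form c c hc (t.vec c) (t.vec c) = 0 := by
          simp only [SignType.coe_neg, SignType.coe_one] at h1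
          linear_combination h1
        rw [(mul_eq_zero.1 h2).resolve_left hk, zero_mul]
      intro i
      by_cases hi : i ∈ posInterval pos p q
      · rw [t.pairing_const _ hS hi hcS, h0]
      · exact t.pairing_eq_zero_of_notMem _ hi
  · refine hyp ?_ fun h => hsd h.2
    intro i
    by_contra hne
    -- A nonzero pairing of t with its dual would make the interval self-dual.
    have := t.eq_of_pairing_ne_zero _ hS (hQ.connectedOn_star hpq hq) hne
    exact hsd fun j => by
      conv_rhs => rw [this]
      rfl

/-- If V = A ⊕ B with A symmetric and nonzero, a thin summand of A is one of V. By hypothesis the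
nondegenerate subrepresentation it generates in A has dimension vector d already, which leaves
nothing for B. -/
theorem isIndecomposableSymmetric_of_thinSummand (hk : (2 : k) ≠ 0)
    (hQ : Q.IsSymmetricChain m pos s) (hs : s ≠ 0) {V : QuiverRep k Q.Double}
    (hV : V.IsSymmetric) {d : Q.Double → ℕ} (hd : ∀ i, Module.finrank k (V.obj i) = d i)
    {i₀ : Q.Double} (h0 : d i₀ ≠ 0)
    (h : ∀ p q, p ≤ q → q < m → ThinSummand V (posInterval pos p q) →
      rootDim s (posInterval pos p q) = d) : V.IsIndecomposableSymmetric := by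
  refine ⟨hV, ?_, ?_⟩
  · intro hz
    apply h0
    rw [← hd]
    have := hz i₀
    exact Module.finrank_zero_of_subsingleton
  · rintro A B ⟨J, hJ⟩ - ⟨H, hH⟩
    by_cases hA : A.IsZero
    · exact Or.inl hA
    · right
      obtain ⟨p, q, hpq, hq, ⟨t⟩, N, -, -, hN⟩ := exists_nondegenerateOn hk hQ hs hA hJ
      have h1 := h p q hpq hq (t.ofSummand H hH)
      intro i
      have h2 := (H i).finrank_eq
      rw [finrank_directSum, hd, ← h1, ← hN] at h2
      have h3 := Submodule.finrank_le (N i)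
      exact Module.finrank_zero_iff.1 (by omega : Module.finrank k (B.obj i) = 0)

theorem exists_isIndecomposableSymmetric (hk : (2 : k) ≠ 0) (hQ : Q.IsSymmetricChain m pos s)
    (hs : s ≠ 0) {p q : ℕ} (hpq : p ≤ q) (hq : q < m) :
    ∃ V : QuiverRep k Q.Double, V.IsIndecomposableSymmetric ∧
      ∀ i, Module.finrank k (V.obj i) = rootDim s (posInterval pos p q) i := by
  have hS := connectedOn_posInterval hQ.chain hpq hq
  obtain ⟨i₀, hi₀⟩ := hS.1
  have h0 := rootDim_ne_zero s hi₀
  by_cases hsd : s = 1 ∧ ∀ j : Q.Double, j.star ∈ posInterval pos p q ↔ j ∈ posInterval pos p q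
  · have hd : ∀ i, Module.finrank k ((thin k (posInterval pos p q)).obj i) =
        rootDim s (posInterval pos p q) i := by
      intro i
      rw [finrank_thin, rootDim, if_pos hsd]
    refine ⟨_, isIndecomposableSymmetric_of_thinSummand hk hQ hs
      (isSymmetric_thin hQ.uniform hsd.1 hsd.2) hd h0 ?_, hd⟩
    intro p' q' hpq' hq' t
    rw [t.eq_of_eq_smul (thinSummandThin k _) (connectedOn_posInterval hQ.chain hpq' hq') hS
      (eq_thinSummandThin k)]
  · have hd : ∀ i, Module.finrank k ((thinDouble k (posInterval pos p q)).obj i) =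
        rootDim s (posInterval pos p q) i := by
      intro i
      rw [finrank_thinDouble, rootDim, if_neg hsd]
    refine ⟨_, isIndecomposableSymmetric_of_thinSummand hk hQ hs
      (isSymmetric_thinDouble hQ.uniform hs _) hd h0 ?_, hd⟩
    intro p' q' hpq' hq' t
    -- The model is the sum of thin representations on S and S*, and both supports give the same
    -- `rootDim`.
    rcases t.eq_or_eq_of_sum (thinSummandFst k _) (thinSummandSnd k _)
      (connectedOn_posInterval hQ.chain hpq' hq') hS (hQ.connectedOn_star hpq hq)
      (eq_thinSummand_add k) with h | h
    · rw [h]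
    · rw [h, rootDim_star]

end QuiverRep

namespace SignedQuiver

variable {Q : SignedQuiver} {m : ℕ} {pos : Q.Double → ℕ} {s : SignType}

open QuiverRep in
theorem symDims_eq {k : Type u} [Field k] (hk : (2 : k) ≠ 0) (hQ : Q.IsSymmetricChain m pos s)
    (hs : s ≠ 0) : symDims k Q = {d | ∃ p q, p ≤ q ∧ q < m ∧
      ∀ i, d i = (rootDim s (posInterval pos p q) i : ℚ)} := by
  ext d
  constructor
  · rintro ⟨V, hV, hd⟩
    obtain ⟨J, hJ⟩ := hV.1
    obtain ⟨p, q, hpq, hq, ⟨t⟩, N, hs', hN, hdim⟩ := exists_nondegenerateOn hk hQ hs hV.2.1 hJ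
    refine ⟨p, q, hpq, hq, fun i => ?_⟩
    obtain ⟨i₀, hi₀⟩ := (connectedOn_posInterval hQ.chain hpq hq).1
    have h0 : N i₀ ≠ ⊥ := by
      intro h
      apply rootDim_ne_zero s hi₀
      rw [← hdim, h, finrank_bot]
    rw [hd, ← hdim, hV.eq_top hJ hs' hN h0 i, finrank_top]
  · rintro ⟨p, q, hpq, hq, hd⟩
    obtain ⟨V, hV, hdim⟩ := exists_isIndecomposableSymmetric hk hQ hs hpq hq
    exact ⟨V, hV, fun i => by rw [hd, hdim]⟩

end SignedQuiver

end

noncomputable section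

/-! ### The symmetric chains of the quivers `B_n` and `C_n` -/

namespace SignedQuiver

variable {n : ℕ} {o : Fin (n - 1) → Bool} {s : SignType}

/-- The position of a vertex in the chain `Q̃`. -/
def chainPos (n : ℕ) (o : Fin (n - 1) → Bool) (s : SignType) : (chain n o s).Double → ℕ
  | .of i => Fin.val (n := n) i
  | .new i _ => 2 * n - 2 - Fin.val (n := n) i

theorem chain_isSingleUnsigned_iff (hs : s ≠ 0) (i : Fin n) :
    (chain n o s).IsSingleUnsigned i ↔ (i : ℕ) + 1 ≠ n := by
  have h : (chain n o s).vsign i = if (i : ℕ) + 1 = n then s else 0 := rfl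
  constructor
  · rintro ⟨-, h2⟩ h3
    rw [h, if_pos h3] at h2
    exact hs h2
  · intro h3
    refine ⟨rfl, ?_⟩
    rw [h, if_neg h3]

theorem chainPos_star (hs : s ≠ 0) (i : (chain n o s).Double) :
    chainPos n o s i.star + chainPos n o s i + 1 = 2 * n - 1 := by
  cases i with
  | of i =>
    have hi : Fin.val (n := n) i < n := Fin.is_lt (n := n) i
    by_cases h : (chain n o s).IsSingleUnsigned i
    · simp only [Double.star, h, dite_true, chainPos]
      omega
    · have h' : Fin.val (n := n) i + 1 = n := by
        by_contra h2
        exact h ((chain_isSingleUnsigned_iff hs i).2 h2)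
      simp only [Double.star, h, dite_false, chainPos]
      change Fin.val (n := n) i + _ + 1 = _
      omega
  | new i h =>
    have hi : Fin.val (n := n) i < n := Fin.is_lt (n := n) i
    simp only [Double.star, chainPos]
    omega

theorem chainPos_injective (hs : s ≠ 0) : Function.Injective (chainPos n o s) := by
  -- A doubled vertex j is not the last one, so its new twin lies strictly to the right of position
  -- n - 1.
  have aux : ∀ (i j : Fin n) (h : (chain n o s).IsSingleUnsigned j),
      chainPos n o s (.of i) ≠ chainPos n o s (.new j h) := by
    intro i j h e
    have := (chain_isSingleUnsigned_iff hs j).1 h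
    simp only [chainPos] at e
    omega
  intro x y hxy
  cases x with
  | of i =>
    cases y with
    | of j => exact congrArg _ (Fin.ext (n := n) hxy)
    | new j h => exact absurd hxy (aux i j h)
  | new i h =>
    cases y with
    | of j => exact absurd hxy.symm (aux j i h)
    | new j h' =>
      have h1 : Fin.val (n := n) i < n := Fin.is_lt (n := n) i
      have h2 : Fin.val (n := n) j < n := Fin.is_lt (n := n) j
      have h3 : Fin.val (n := n) i = Fin.val (n := n) j := by
        simp only [chainPos] at hxy
        omega
      have h4 : i = j := Fin.ext (n := n) h3
      subst h4
      rfl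

/-- The position of the left end of an arrow. -/
def arrowPos (n : ℕ) (o : Fin (n - 1) → Bool) (s : SignType) : (chain n o s).DoubleArrow → ℕ
  | .of a => Fin.val (n := n - 1) a
  -- The mirror image of the edge {a, a + 1} is {2n - 3 - a, 2n - 2 - a}.
  | .new a _ => 2 * n - 3 - Fin.val (n := n - 1) a

/-- Whether an arrow points to the right. -/
def arrowDir (n : ℕ) (o : Fin (n - 1) → Bool) (s : SignType) : (chain n o s).DoubleArrow → Bool
  | .of a => o a
  -- Reflecting the chain and reversing the arrow cancel, so φ* points in the same direction as φ.
  | .new a _ => o a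

theorem arrowPos_injective : Function.Injective (arrowPos n o s) := by
  intro a b hab
  cases a with
  | of a =>
    cases b with
    | of b => exact congrArg _ (Fin.ext (n := n - 1) hab)
    | new b h =>
      have h1 : Fin.val (n := n - 1) a < n - 1 := Fin.is_lt (n := n - 1) a
      have h2 : Fin.val (n := n - 1) b < n - 1 := Fin.is_lt (n := n - 1) b
      simp only [arrowPos] at hab
      omega
  | new a h =>
    have h1 : Fin.val (n := n - 1) a < n - 1 := Fin.is_lt (n := n - 1) a
    cases b with
    | of b =>
      have h2 : Fin.val (n := n - 1) b < n - 1 := Fin.is_lt (n := n - 1) b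
      simp only [arrowPos] at hab
      omega
    | new b h' =>
      have h2 : Fin.val (n := n - 1) b < n - 1 := Fin.is_lt (n := n - 1) b
      have h3 : a = b := Fin.ext (n := n - 1) (by
        simp only [arrowPos] at hab
        omega)
      subst h3
      rfl

theorem arrowPos_surjective {p : ℕ} (hp : p + 1 < 2 * n - 1) :
    ∃ a, arrowPos n o s a = p := by
  by_cases h : p < n - 1
  · exact ⟨.of (⟨p, h⟩ : Fin (n - 1)), rfl⟩
  · refine ⟨.new (⟨2 * n - 3 - p, by omega⟩ : Fin (n - 1)) rfl, ?_⟩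
    change 2 * n - 3 - (2 * n - 3 - p) = p
    omega

theorem chainPos_tail_head (hs : s ≠ 0) (a : (chain n o s).DoubleArrow) :
    (arrowDir n o s a = true ∧ chainPos n o s a.tail = arrowPos n o s a ∧
      chainPos n o s a.head = arrowPos n o s a + 1) ∨
    (arrowDir n o s a = false ∧ chainPos n o s a.head = arrowPos n o s a ∧
      chainPos n o s a.tail = arrowPos n o s a + 1) := by
  have key : ∀ a : Fin (n - 1),
      (o a = true ∧ chainPos n o s (.of ((chain n o s).tail a)) = a ∧
        chainPos n o s (.of ((chain n o s).head a)) = a + 1) ∨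
      (o a = false ∧ chainPos n o s (.of ((chain n o s).head a)) = a ∧
        chainPos n o s (.of ((chain n o s).tail a)) = a + 1) := by
    intro a
    have h1 : (chain n o s).tail a = if o a then (⟨a, by omega⟩ : Fin n) else ⟨a + 1, by omega⟩ := rfl
    have h2 : (chain n o s).head a = if o a then (⟨a + 1, by omega⟩ : Fin n) else ⟨a, by omega⟩ := rfl
    rw [h1, h2]
    cases o a
    · exact Or.inr ⟨rfl, rfl, rfl⟩
    · exact Or.inl ⟨rfl, rfl, rfl⟩
  cases a with
  | of a => exact key a
  | new a h =>
    have h1 := chainPos_star hs (.of ((chain n o s).tail a))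
    have h2 := chainPos_star hs (.of ((chain n o s).head a))
    have h3 : Fin.val (n := n - 1) a < n - 1 := Fin.is_lt (n := n - 1) a
    simp only [arrowDir, arrowPos, DoubleArrow.tail, DoubleArrow.head]
    rcases key a with ⟨e1, e2, e3⟩ | ⟨e1, e2, e3⟩
    · exact Or.inl ⟨e1, by omega, by omega⟩
    · exact Or.inr ⟨e1, by omega, by omega⟩

theorem isChainQuiver_chain (hn : 1 ≤ n) (hs : s ≠ 0) :
    IsChainQuiver (chain n o s).Double (2 * n - 1) (chainPos n o s) where
  inj := chainPos_injective hs
  lt x := by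
    have := chainPos_star hs x
    omega
  surj p hp := by
    by_cases h : p < n
    · exact ⟨.of (⟨p, h⟩ : Fin n), rfl⟩
    · refine ⟨Double.star (.of (⟨2 * n - 2 - p, by omega⟩ : Fin n)), ?_⟩
      have := chainPos_star hs (.of (⟨2 * n - 2 - p, by omega⟩ : Fin n) : (chain n o s).Double)
      change _ + (2 * n - 2 - p) + 1 = _ at this
      omega
  adj x y φ := by
    obtain ⟨a, rfl, rfl⟩ := φ
    have := chainPos_tail_head hs a
    omega
  edge x y hxy := by
    have hy := chainPos_star hs y
    obtain ⟨a, ha⟩ := arrowPos_surjective (n := n) (o := o) (s := s) (p := chainPos n o s x)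
      (by omega)
    -- An arrow is determined by the position of its left end, so the arrow at `pos x` is the only
    -- one between x and y, and its direction decides the case.
    rcases chainPos_tail_head hs a with ⟨h1, h2, h3⟩ | ⟨h1, h2, h3⟩
    · left
      refine ⟨⟨a, chainPos_injective hs (by omega), chainPos_injective hs (by omega)⟩, ?_, ⟨?_⟩⟩
      · rintro ⟨b, rfl, rfl⟩
        have := chainPos_tail_head hs b
        exact Subtype.ext (arrowPos_injective (by dsimp only; omega))
      · rintro ⟨b, rfl, rfl⟩
        have hb := chainPos_tail_head hs b
        obtain rfl : b = a := arrowPos_injective (by omega)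
        omega
    · right
      refine ⟨⟨a, chainPos_injective hs (by omega), chainPos_injective hs (by omega)⟩, ?_, ⟨?_⟩⟩
      · rintro ⟨b, rfl, rfl⟩
        have := chainPos_tail_head hs b
        exact Subtype.ext (arrowPos_injective (by dsimp only; omega))
      · rintro ⟨b, rfl, rfl⟩
        have hb := chainPos_tail_head hs b
        obtain rfl : b = a := arrowPos_injective (by omega)
        omega

theorem hasUniformSign_chain (hs : s ≠ 0) : (chain n o s).HasUniformSign s where
  arrow_sign a := by cases a <;> rfl
  sign_of_fixed i hi := by
    have h1 := chainPos_star hs i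
    rw [hi] at h1
    cases i with
    | of i =>
      have h2 : chainPos n o s (.of i) = Fin.val (n := n) i := rfl
      exact if_pos (by omega)
    | new i h =>
      have h2 : chainPos n o s (.new i h) = 2 * n - 2 - Fin.val (n := n) i := rfl
      have h3 := (chain_isSingleUnsigned_iff hs i).1 h
      omega
  sign_of_ne i hi := by
    cases i with
    | of i =>
      have h1 := chainPos_star hs (.of i)
      have h2 : chainPos n o s (.of i) = Fin.val (n := n) i := rfl
      refine if_neg fun h => hi (chainPos_injective hs (by omega))
    | new i h => rfl

theorem isSymmetricChain_chain (hn : 1 ≤ n) (hs : s ≠ 0) :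
    (chain n o s).IsSymmetricChain (2 * n - 1) (chainPos n o s) s where
  uniform := hasUniformSign_chain hs
  chain := isChainQuiver_chain hn hs
  pos_star := chainPos_star hs
  odd := ⟨n - 1, by omega⟩

end SignedQuiver

end

noncomputable section

/-! ### Root systems from sets of vectors -/

open Matrix

namespace RootPairing.Base

theorem exists_sum_of_mem_closure {ι R M N : Type*} [CommRing R] [AddCommGroup M] [Module R M]
    [AddCommGroup N] [Module R N] {P : RootPairing ι R M N} (b : P.Base) {x : M}
    (hx : x ∈ AddSubmonoid.closure (P.root '' b.support)) :
    ∃ f : ι → ℤ, 0 ≤ f ∧ x = ∑ j ∈ b.support, f j • P.root j := by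
  classical
  induction hx using AddSubmonoid.closure_induction with
  | mem x hx =>
    obtain ⟨j, hj, rfl⟩ := hx
    refine ⟨Pi.single j 1, Pi.single_nonneg.2 zero_le_one, ?_⟩
    rw [Finset.sum_eq_single_of_mem j hj]
    · simp
    · intro i _ hij
      simp [hij]
  | zero => exact ⟨0, le_rfl, by simp⟩
  | add x y _ _ hx hy =>
    obtain ⟨f, hf, rfl⟩ := hx
    obtain ⟨g, hg, rfl⟩ := hy
    exact ⟨f + g, add_nonneg hf hg, by simp [add_smul, Finset.sum_add_distrib]⟩

theorem isPos_of_mem_closure {ι R M N : Type*} [CommRing R] [AddCommGroup M] [Module R M]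
    [AddCommGroup N] [Module R N] [CharZero R] {P : RootPairing ι R M N} (b : P.Base) {i : ι}
    (hi : P.root i ∈ AddSubmonoid.closure (P.root '' b.support)) : b.IsPos i := by
  obtain ⟨f, hf, h⟩ := b.exists_sum_of_mem_closure hi
  -- The height of a root is the sum of its coefficients, and nonnegative height is enough for
  -- positivity.
  rw [isPos_iff', height_eq_sum h]
  exact Finset.sum_nonneg fun j _ => hf j

theorem not_isPos_of_neg_mem_closure {ι R M N : Type*} [CommRing R] [AddCommGroup M] [Module R M]
    [AddCommGroup N] [Module R N] [CharZero R] {P : RootPairing ι R M N} (b : P.Base) {i : ι}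
    (hi : -P.root i ∈ AddSubmonoid.closure (P.root '' b.support)) : ¬ b.IsPos i := by
  obtain ⟨f, hf, h⟩ := b.exists_sum_of_mem_closure hi
  have h' : P.root i = ∑ j ∈ b.support, (-f) j • P.root j := by
    rw [← neg_neg (P.root i), h, ← Finset.sum_neg_distrib]
    simp
  rw [isPos_iff, height_eq_sum h', not_lt]
  exact Finset.sum_nonpos fun j _ => by simpa using hf j

end RootPairing.Base

/-- The axioms of a reduced crystallographic root system, except finiteness and spanning, for a set
of vectors in the standard Euclidean space. -/
structure IsRootVectors {n : ℕ} (R : Set (Fin n → ℚ)) : Prop where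
  ne : ∀ x ∈ R, x ⬝ᵥ x ≠ 0
  refl : ∀ x ∈ R, ∀ y ∈ R, y - (2 / (x ⬝ᵥ x) * (x ⬝ᵥ y)) • x ∈ R
  int : ∀ x ∈ R, ∀ y ∈ R, ∃ z : ℤ, (z : ℚ) = 2 / (y ⬝ᵥ y) * (y ⬝ᵥ x)
  red : ∀ x ∈ R, ∀ c : ℚ, c • x ∈ R → c = 1 ∨ c = -1

/-- Takes x to its coroot 2(x, ·)/(x, x) in Euclidean coordinates and transports everything along Φ.
The n independent vectors α span, so the span of D is exactly the image of Φ. -/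
theorem isPositiveRootsOfType_of_vectors {X : Type} {n : ℕ} {R Rpos : Set (Fin n → ℚ)}
    {α : Fin n → Fin n → ℚ} {A : Matrix (Fin n) (Fin n) ℤ}
    (Φ : (Fin n → ℚ) →ₗ[ℚ] X → ℚ) (hΦ : Function.Injective Φ)
    (hfin : Rpos.Finite) (hR : ∀ x, x ∈ R ↔ x ∈ Rpos ∨ -x ∈ Rpos)
    (hroot : IsRootVectors R)
    (hα : ∀ i, α i ∈ Rpos) (hli : LinearIndependent ℚ α)
    (hpos : ∀ x ∈ Rpos, x ∈ AddSubmonoid.closure (Set.range α))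
    (hA : ∀ i j, (A i j : ℚ) = 2 / (α j ⬝ᵥ α j) * (α j ⬝ᵥ α i)) :
    IsPositiveRootsOfType (Φ '' Rpos) A (fun i => Φ (α i)) := by
  classical
  obtain ⟨hne, hrefl, hint, hred⟩ := hroot
  have hsub : Rpos ⊆ R := fun x hx => (hR x).2 (Or.inl hx)
  have hspan : Submodule.span ℚ (Set.range α) = ⊤ :=
    hli.span_eq_top_of_card_eq_finrank' (by simp)
  have hspanpos : Submodule.span ℚ Rpos = ⊤ := by
    rw [eq_top_iff, ← hspan]
    exact Submodule.span_mono (by rintro _ ⟨i, rfl⟩; exact hα i)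
  have hrange : LinearMap.range Φ = Submodule.span ℚ (Φ '' Rpos) := by
    rw [Submodule.span_image, hspanpos, Submodule.map_top]
  let Ψ : (Fin n → ℚ) ≃ₗ[ℚ] Submodule.span ℚ (Φ '' Rpos) :=
    (LinearEquiv.ofInjective Φ hΦ).trans (LinearEquiv.ofEq _ _ hrange)
  have hΨ : ∀ x, (Ψ x : X → ℚ) = Φ x := fun x => rfl
  have hRfin : R.Finite := by
    have : R = Rpos ∪ Neg.neg ⁻¹' Rpos := Set.ext hR
    rw [this]
    exact hfin.union (hfin.preimage neg_injective.injOn)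
  have : Finite R := hRfin
  let root : R ↪ Submodule.span ℚ (Φ '' Rpos) :=
    ⟨fun x => Ψ x, fun x y h => Subtype.ext (Ψ.injective h)⟩
  let cor : R → Module.Dual ℚ (Submodule.span ℚ (Φ '' Rpos)) := fun x =>
    (2 / ((x : Fin n → ℚ) ⬝ᵥ x)) •
      (dotProductBilin ℚ ℚ (x : Fin n → ℚ) ∘ₗ (Ψ.symm : _ →ₗ[ℚ] (Fin n → ℚ)))
  have hcor : ∀ (x : R) (y : Fin n → ℚ), cor x (Ψ y) = 2 / ((x : Fin n → ℚ) ⬝ᵥ x) * (x ⬝ᵥ y) := by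
    intro x y
    simp [cor]
  have hcor2 : ∀ x : R, cor x (Ψ x) = 2 := by
    intro x
    rw [hcor, div_mul_cancel₀ _ (hne x x.2)]
  have hcorinj : Function.Injective cor := by
    intro x y h
    have h1 : cor x (Ψ y) = 2 := by rw [h, hcor2]
    have h2 : cor y (Ψ x) = 2 := by rw [← h, hcor2]
    rw [hcor, div_mul_eq_mul_div, div_eq_iff (hne x x.2)] at h1
    rw [hcor, div_mul_eq_mul_div, div_eq_iff (hne y y.2), dotProduct_comm] at h2
    -- Equal coroots give (x, y) = (x, x) = (y, y), so x - y has length zero.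
    have h3 : ((x : Fin n → ℚ) - (y : Fin n → ℚ)) ⬝ᵥ ((x : Fin n → ℚ) - (y : Fin n → ℚ)) = 0 := by
      rw [sub_dotProduct, dotProduct_sub, dotProduct_sub, dotProduct_comm (y : Fin n → ℚ) x]
      linarith
    exact Subtype.ext (sub_eq_zero.1 (dotProduct_self_eq_zero.1 h3))
  let coroot : R ↪ Module.Dual ℚ (Submodule.span ℚ (Φ '' Rpos)) := ⟨cor, hcorinj⟩
  let p := Module.Dual.eval ℚ (Submodule.span ℚ (Φ '' Rpos))
  have : Module.Finite ℚ (Submodule.span ℚ (Φ '' Rpos)) := Module.Finite.equiv Ψ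
  have hp : ∀ i, p (root i) (coroot i) = 2 := hcor2
  have hs : ∀ i, Set.MapsTo (Module.preReflection (root i) (p.flip (coroot i)))
      (Set.range root) (Set.range root) := by
    rintro x _ ⟨y, rfl⟩
    refine ⟨⟨_, hrefl x x.2 y y.2⟩, ?_⟩
    change Ψ (_ - _ • _) = Ψ y - cor x (Ψ y) • Ψ x
    rw [map_sub, map_smul, hcor]
  have hrootrange : Set.range root = Ψ '' R := by
    ext z
    constructor
    · rintro ⟨x, rfl⟩
      exact ⟨x, x.2, rfl⟩
    · rintro ⟨x, hx, rfl⟩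
      exact ⟨⟨x, hx⟩, rfl⟩
  have hsp : Submodule.span ℚ (Set.range root) = ⊤ := by
    have h1 : Submodule.span ℚ R = ⊤ := by
      rw [eq_top_iff, ← hspanpos]
      exact Submodule.span_mono hsub
    have h2 := Submodule.span_image (Ψ : (Fin n → ℚ) →ₗ[ℚ] Submodule.span ℚ (Φ '' Rpos)) (s := R)
    rw [h1, Submodule.map_top, LinearEquiv.range] at h2
    rw [hrootrange]
    exact h2
  have h_int : ∀ i j, ∃ z : ℤ, (z : ℚ) = p (root i) (coroot j) := by
    intro x y
    obtain ⟨z, hz⟩ := hint x x.2 y y.2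
    exact ⟨z, hz.trans (hcor y x).symm⟩
  let P := RootPairing.mk'' p root coroot hp hs hsp
  have hProot : ∀ x : R, P.root x = Ψ x := fun x => rfl
  have hPpair : ∀ x y : R, P.pairing x y = cor y (Ψ x) := fun x y => rfl
  have hrs : P.IsRootSystem := RootPairing.isRootSystem_mk'' h_int
  have hcr : P.IsCrystallographic := ⟨h_int⟩
  have hrd : P.IsReduced := by
    refine ⟨fun x y h => ?_⟩
    rw [LinearIndependent.pair_iff' (P.ne_zero x)] at h
    push Not at h
    obtain ⟨c, hc⟩ := h
    rw [hProot, hProot, ← map_smul] at hc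
    have hc := Ψ.injective hc
    rcases hred x x.2 c (by rw [hc]; exact y.2) with rfl | rfl
    · left
      rw [hProot, hProot, ← hc, one_smul]
    · right
      rw [hProot, hProot, ← hc, neg_smul, one_smul, map_neg, neg_neg]
  let a : Fin n → R := fun i => ⟨α i, hsub (hα i)⟩
  have ha : Function.Injective a := fun i j h => hli.injective (congrArg Subtype.val h)
  have himage : P.root '' Set.range a = Ψ '' Set.range α := by
    rw [← Set.range_comp, ← Set.range_comp]
    rfl
  have hclosure : ∀ x : R, (x : Fin n → ℚ) ∈ Rpos →
      P.root x ∈ AddSubmonoid.closure (P.root '' Set.range a) := by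
    intro x hx
    rw [himage]
    have := AddSubmonoid.mem_map_of_mem (Ψ : (Fin n → ℚ) →+ Submodule.span ℚ (Φ '' Rpos))
      (hpos x hx)
    rw [AddMonoidHom.map_mclosure] at this
    exact this
  have hclosure' : ∀ x : R, -(x : Fin n → ℚ) ∈ Rpos →
      -P.root x ∈ AddSubmonoid.closure (P.root '' Set.range a) := by
    intro x hx
    have := hclosure ⟨-x, hsub hx⟩ hx
    rw [hProot] at this ⊢
    rwa [← map_neg]
  let b : P.Base := RootPairing.Base.mk' P (Set.range a)
    (by
      rw [linearIndepOn_range_iff ha]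
      exact hli.map' (Ψ : (Fin n → ℚ) →ₗ[ℚ] Submodule.span ℚ (Φ '' Rpos)) Ψ.ker)
    (fun x => ((hR x).1 x.2).imp (hclosure x) (hclosure' x))
  have hbs : (b.support : Set R) = Set.range a := Set.Finite.coe_toFinset _
  have hbm : ∀ i, a i ∈ b.support := fun i => by
    rw [← Finset.mem_coe, hbs]
    exact ⟨i, rfl⟩
  have hpos_iff : ∀ x : R, b.IsPos x ↔ (x : Fin n → ℚ) ∈ Rpos := by
    intro x
    constructor
    · intro hx
      refine ((hR x).1 x.2).resolve_right fun h => ?_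
      have := hclosure' x h
      rw [← hbs] at this
      exact b.not_isPos_of_neg_mem_closure this hx
    · intro hx
      have := hclosure x hx
      rw [← hbs] at this
      exact b.isPos_of_mem_closure this
  let e : Fin n ≃ b.support := Equiv.ofBijective (fun i => ⟨a i, hbm i⟩) (by
    constructor
    · intro i j h
      exact ha (congrArg Subtype.val h)
    · rintro ⟨x, hx⟩
      rw [← Finset.mem_coe, hbs] at hx
      obtain ⟨i, rfl⟩ := hx
      exact ⟨i, rfl⟩)
  refine ⟨R, inferInstance, P, hrs, hcr, hrd, b, e, ?_, ?_, fun i => rfl, ?_⟩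
  · ext d
    constructor
    · rintro ⟨x, rfl⟩
      refine ((hR x).1 x.2).imp (fun h => ⟨x, h, rfl⟩) (fun h => ⟨-x, h, ?_⟩)
      rw [map_neg]
      rfl
    · rintro (⟨x, hx, rfl⟩ | ⟨x, hx, h⟩)
      · exact ⟨⟨x, hsub hx⟩, rfl⟩
      · refine ⟨⟨-x, (hR _).2 (Or.inr (by rwa [neg_neg]))⟩, ?_⟩
        change Φ (-x) = d
        rw [map_neg, h, neg_neg]
  · ext d
    constructor
    · rintro ⟨x, hx, rfl⟩
      exact ⟨x, (hpos_iff x).1 hx, rfl⟩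
    · rintro ⟨x, hx, rfl⟩
      exact ⟨⟨x, hsub hx⟩, (hpos_iff _).2 hx, rfl⟩
  · intro i j
    have h1 := b.algebraMap_cartanMatrixIn_apply ℤ (e i) (e j)
    rw [hPpair] at h1
    have h2 : cor (e j) (Ψ (e i : R)) = (A i j : ℚ) := (hcor _ _).trans (hA i j).symm
    have h3 : ((b.cartanMatrixIn ℤ (e i) (e j) : ℤ) : ℚ) = A i j := h1.trans h2
    exact_mod_cast h3

end

noncomputable section

/-! ### The root systems of types `B_n` and `C_n` -/

open Matrix

variable {n : ℕ}

/-- The vector `2 x / (x, x)`. -/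
def corootVector (x : Fin n → ℚ) : Fin n → ℚ := (2 / (x ⬝ᵥ x)) • x

theorem corootVector_dotProduct_self (x : Fin n → ℚ) :
    corootVector x ⬝ᵥ corootVector x = 4 / (x ⬝ᵥ x) := by
  by_cases hx : x ⬝ᵥ x = 0
  -- For x = 0 both sides are zero, since division by zero is zero.
  · simp [corootVector, hx]
  · simp only [corootVector, smul_dotProduct, dotProduct_smul, smul_eq_mul]
    field_simp
    norm_num

theorem corootVector_corootVector (x : Fin n → ℚ) : corootVector (corootVector x) = x := by
  by_cases hx : x ⬝ᵥ x = 0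
  · rw [dotProduct_self_eq_zero] at hx
    simp [corootVector, hx]
  · rw [corootVector, corootVector_dotProduct_self, corootVector, smul_smul]
    rw [show 2 / (4 / (x ⬝ᵥ x)) * (2 / (x ⬝ᵥ x)) = 1 by field_simp; norm_num, one_smul]

theorem corootVector_smul (c : ℚ) (x : Fin n → ℚ) :
    corootVector (c • x) = c⁻¹ • corootVector x := by
  by_cases hc : c = 0
  · simp [corootVector, hc]
  by_cases hx : x ⬝ᵥ x = 0
  · simp [corootVector, hx]
  simp only [corootVector, smul_dotProduct, dotProduct_smul, smul_eq_mul, smul_smul]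
  congr 1
  field_simp

theorem corootVector_neg (x : Fin n → ℚ) : corootVector (-x) = -corootVector x := by
  rw [← neg_one_smul ℚ x, corootVector_smul]
  simp

theorem corootVector_dotProduct (x y : Fin n → ℚ) :
    2 / (x ⬝ᵥ x) * (x ⬝ᵥ y) = corootVector x ⬝ᵥ y := by
  rw [corootVector, smul_dotProduct, smul_eq_mul]

/-- A vector and its coroot define the same reflection, and since reflections preserve lengths they
commute with y ↦ 2y/(y, y). -/
theorem corootVector_reflection {x : Fin n → ℚ} (hx : x ⬝ᵥ x ≠ 0) (y : Fin n → ℚ) :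
    corootVector (y - (2 / (x ⬝ᵥ x) * (x ⬝ᵥ y)) • x) =
      corootVector y - (2 / (corootVector x ⬝ᵥ corootVector x) *
        (corootVector x ⬝ᵥ corootVector y)) • corootVector x := by
  have h : (y - (2 / (x ⬝ᵥ x) * (x ⬝ᵥ y)) • x) ⬝ᵥ (y - (2 / (x ⬝ᵥ x) * (x ⬝ᵥ y)) • x) =
      y ⬝ᵥ y := by
    simp only [sub_dotProduct, dotProduct_sub, smul_dotProduct, dotProduct_smul, smul_eq_mul,
      dotProduct_comm y x]
    field_simp
    ring
  rw [corootVector_dotProduct_self]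
  unfold corootVector
  rw [h, smul_sub]
  simp only [smul_dotProduct, dotProduct_smul, smul_eq_mul, smul_smul]
  congr 2
  by_cases hy : y ⬝ᵥ y = 0
  · simp [hy]
  field_simp
  ring

/-- The dual of a root system is a root system. -/
theorem IsRootVectors.preimage_corootVector {R : Set (Fin n → ℚ)} (hR : IsRootVectors R) :
    IsRootVectors (corootVector ⁻¹' R) where
  ne x hx h := hR.ne _ hx (by rw [corootVector_dotProduct_self, h, div_zero])
  refl x hx y hy := by
    have h : x ⬝ᵥ x ≠ 0 := fun h => hR.ne _ hx (by rw [corootVector_dotProduct_self, h, div_zero])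
    rw [Set.mem_preimage, corootVector_reflection h]
    exact hR.refl _ hx _ hy
  int x hx y hy := by
    obtain ⟨z, hz⟩ := hR.int _ hy _ hx
    refine ⟨z, hz.trans ?_⟩
    rw [corootVector_dotProduct, corootVector_dotProduct, corootVector_corootVector,
      dotProduct_comm]
  red x hx c hc := by
    rw [Set.mem_preimage, corootVector_smul] at hc
    rcases hR.red _ hx _ hc with h | h
    · exact Or.inl (inv_eq_one.1 h)
    · right
      rw [← inv_inv c, h]
      norm_num

/-! ### The roots of type `B_n` as short integral vectors. -/

/-- The integral vectors of square length `1` or `2`. -/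
def shortIntegralVectors (n : ℕ) : Set (Fin n → ℚ) :=
  {x | (∀ a, ∃ z : ℤ, x a = z) ∧ (x ⬝ᵥ x = 1 ∨ x ⬝ᵥ x = 2)}

theorem exists_int_dotProduct {x y : Fin n → ℚ} (hx : ∀ a, ∃ z : ℤ, x a = z)
    (hy : ∀ a, ∃ z : ℤ, y a = z) : ∃ z : ℤ, x ⬝ᵥ y = z := by
  choose f hf using hx
  choose g hg using hy
  refine ⟨∑ a, f a * g a, ?_⟩
  simp [dotProduct, hf, hg]

/-- The factor 2/(x, x) is 2 or 1, and inner products of integral vectors are integers. -/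
theorem shortIntegralVectors_exists_int {x y : Fin n → ℚ} (hx : x ∈ shortIntegralVectors n)
    (hy : y ∈ shortIntegralVectors n) : ∃ z : ℤ, (z : ℚ) = 2 / (x ⬝ᵥ x) * (x ⬝ᵥ y) := by
  obtain ⟨z, hz⟩ := exists_int_dotProduct hx.1 hy.1
  rcases hx.2 with h | h
  · refine ⟨2 * z, ?_⟩
    rw [h, hz]
    push_cast
    ring
  · refine ⟨z, ?_⟩
    rw [h, hz]
    ring

theorem isRootVectors_shortIntegralVectors : IsRootVectors (shortIntegralVectors n) where
  ne x hx := by rcases hx.2 with h | h <;> rw [h] <;> norm_num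
  refl x hx y hy := by
    obtain ⟨z, hz⟩ := shortIntegralVectors_exists_int hx hy
    constructor
    · intro a
      obtain ⟨p, hp⟩ := hx.1 a
      obtain ⟨q, hq⟩ := hy.1 a
      refine ⟨q - z * p, ?_⟩
      rw [← hz, Pi.sub_apply, Pi.smul_apply, hp, hq, smul_eq_mul]
      push_cast
      rfl
    · have h : (y - (2 / (x ⬝ᵥ x) * (x ⬝ᵥ y)) • x) ⬝ᵥ (y - (2 / (x ⬝ᵥ x) * (x ⬝ᵥ y)) • x) =
          y ⬝ᵥ y := by
        have hx0 : x ⬝ᵥ x ≠ 0 := by rcases hx.2 with h | h <;> rw [h] <;> norm_num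
        simp only [sub_dotProduct, dotProduct_sub, smul_dotProduct, dotProduct_smul, smul_eq_mul,
          dotProduct_comm y x]
        field_simp
        ring
      rw [h]
      exact hy.2
  int x hx y hy := shortIntegralVectors_exists_int hy hx
  red x hx c hc := by
    have h1 := hc.2
    rw [smul_dotProduct, dotProduct_smul, smul_eq_mul, smul_eq_mul] at h1
    have two_ne : ∀ d : ℚ, d * d ≠ 2 := by
      intro d hd
      have : IsSquare (2 : ℚ) := ⟨d, hd.symm⟩
      rw [show (2 : ℚ) = ((2 : ℕ) : ℚ) by norm_num, Rat.isSquare_natCast_iff] at this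
      obtain ⟨m, hm⟩ := this
      have : m < 2 := by nlinarith
      interval_cases m <;> omega
    have hcc : c * c = 1 := by
      rcases hx.2 with h | h <;> rw [h] at h1 <;> rcases h1 with h1 | h1
      · linarith
      · exact absurd (by linarith) (two_ne c)
      -- Here c² = 1/2, so 2c would be a rational square root of 2.
      · exact absurd (by linarith) (two_ne (2 * c))
      · linarith
    exact mul_self_eq_one_iff.1 hcc

/-- An integral vector of square length at most `2` that is not zero has a coordinate `± 1`, whose
removal lowers the square length by `1`. -/
theorem exists_sub_single {x : Fin n → ℚ} (hx : ∀ a, ∃ z : ℤ, x a = z) (h0 : x ⬝ᵥ x ≠ 0)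
    (h2 : x ⬝ᵥ x ≤ 2) : ∃ a, (x a = 1 ∨ x a = -1) ∧
      (x - Pi.single a (x a)) ⬝ᵥ (x - Pi.single a (x a)) = x ⬝ᵥ x - 1 := by
  obtain ⟨a, ha⟩ : ∃ a, x a ≠ 0 := by
    by_contra! h
    exact h0 (by rw [show x = 0 from funext h, zero_dotProduct])
  have h1 : x a * x a ≤ x ⬝ᵥ x :=
    Finset.single_le_sum (f := fun a => x a * x a) (fun b _ => mul_self_nonneg (x b))
      (Finset.mem_univ a)
  have hxa : x a = 1 ∨ x a = -1 := by
    obtain ⟨z, hz⟩ := hx a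
    rw [hz] at ha h1 ⊢
    have h3 : ((z * z : ℤ) : ℚ) ≤ ((2 : ℤ) : ℚ) := by
      push_cast
      linarith
    have h4 : z * z ≤ 2 := by exact_mod_cast h3
    have h5 : z ≠ 0 := by exact_mod_cast ha
    have h6 : z ≤ 1 := by nlinarith
    have h7 : -1 ≤ z := by nlinarith
    have : z = 1 ∨ z = -1 := by omega
    rcases this with rfl | rfl
    · left; norm_num
    · right; norm_num
  refine ⟨a, hxa, ?_⟩
  rw [sub_dotProduct, dotProduct_sub, dotProduct_sub, single_dotProduct, single_dotProduct,
    dotProduct_single, Pi.single_eq_same]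
  rcases hxa with h | h <;> rw [h] <;> ring

/-- The vectors `e_a - e_b` and `e_a + e_b` for `a < b`, and `t e_a`. -/
inductive IsChainRoot (t : ℚ) : (Fin n → ℚ) → Prop
  | sub (a b : Fin n) (h : a < b) : IsChainRoot t (Pi.single a 1 - Pi.single b 1)
  | add (a b : Fin n) (h : a < b) : IsChainRoot t (Pi.single a 1 + Pi.single b 1)
  | single (a : Fin n) : IsChainRoot t (t • Pi.single a 1)

theorem finite_isChainRoot (t : ℚ) : {x : Fin n → ℚ | IsChainRoot t x}.Finite := by
  refine (((Set.finite_range fun p : Fin n × Fin n =>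
    (Pi.single p.1 1 - Pi.single p.2 1 : Fin n → ℚ)).union (Set.finite_range fun p : Fin n × Fin n =>
    (Pi.single p.1 1 + Pi.single p.2 1 : Fin n → ℚ))).union (Set.finite_range fun a : Fin n =>
    t • (Pi.single a 1 : Fin n → ℚ))).subset ?_
  rintro _ (⟨a, b, -⟩ | ⟨a, b, -⟩ | a)
  · exact Or.inl (Or.inl ⟨(a, b), rfl⟩)
  · exact Or.inl (Or.inr ⟨(a, b), rfl⟩)
  · exact Or.inr ⟨a, rfl⟩

theorem single_sub_single_dotProduct_self {a b : Fin n} (h : a ≠ b) :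
    (Pi.single a 1 - Pi.single b 1 : Fin n → ℚ) ⬝ᵥ (Pi.single a 1 - Pi.single b 1) = 2 := by
  simp [h, h.symm]
  norm_num

theorem single_add_single_dotProduct_self {a b : Fin n} (h : a ≠ b) :
    (Pi.single a 1 + Pi.single b 1 : Fin n → ℚ) ⬝ᵥ (Pi.single a 1 + Pi.single b 1) = 2 := by
  simp [h, h.symm]
  norm_num

theorem exists_int_single (a b : Fin n) : ∃ z : ℤ, (Pi.single a 1 : Fin n → ℚ) b = z :=
  ⟨(Pi.single a 1 : Fin n → ℤ) b, by by_cases h : b = a <;> simp [h]⟩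

theorem IsChainRoot.mem_shortIntegralVectors {x : Fin n → ℚ} (hx : IsChainRoot 1 x) :
    x ∈ shortIntegralVectors n := by
  rcases hx with ⟨a, b, h⟩ | ⟨a, b, h⟩ | a
  · refine ⟨fun c => ?_, Or.inr (single_sub_single_dotProduct_self h.ne)⟩
    obtain ⟨z, hz⟩ := exists_int_single a c
    obtain ⟨w, hw⟩ := exists_int_single b c
    exact ⟨z - w, by rw [Pi.sub_apply, hz, hw]; push_cast; rfl⟩
  · refine ⟨fun c => ?_, Or.inr (single_add_single_dotProduct_self h.ne)⟩
    obtain ⟨z, hz⟩ := exists_int_single a c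
    obtain ⟨w, hw⟩ := exists_int_single b c
    exact ⟨z + w, by rw [Pi.add_apply, hz, hw]; push_cast; rfl⟩
  · rw [one_smul]
    exact ⟨exists_int_single a, Or.inl (by simp)⟩

theorem neg_mem_shortIntegralVectors {x : Fin n → ℚ} (hx : x ∈ shortIntegralVectors n) :
    -x ∈ shortIntegralVectors n := by
  refine ⟨fun a => ?_, by rw [neg_dotProduct, dotProduct_neg, neg_neg]; exact hx.2⟩
  obtain ⟨z, hz⟩ := hx.1 a
  exact ⟨-z, by rw [Pi.neg_apply, hz]; push_cast; rfl⟩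

/-- Removing a coordinate ±1 lowers the square length by 1, so one removal exhausts a vector of
square length 1 and two exhaust one of square length 2. The signs and the order of the two
coordinates give the cases. -/
theorem mem_shortIntegralVectors_iff (x : Fin n → ℚ) :
    x ∈ shortIntegralVectors n ↔ IsChainRoot 1 x ∨ IsChainRoot 1 (-x) := by
  constructor
  · rintro ⟨hx, h⟩
    have h0 : x ⬝ᵥ x ≠ 0 := by rcases h with h | h <;> rw [h] <;> norm_num
    have h2 : x ⬝ᵥ x ≤ 2 := by rcases h with h | h <;> rw [h]; norm_num
    obtain ⟨a, ha, h1⟩ := exists_sub_single hx h0 h2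
    rcases h with h | h
    · rw [h, sub_self, dotProduct_self_eq_zero, sub_eq_zero] at h1
      rw [h1]
      rcases ha with ha | ha <;> rw [ha]
      · left
        simpa using IsChainRoot.single (t := 1) a
      · right
        simpa [← Pi.single_neg] using IsChainRoot.single (t := 1) a
    · rw [h] at h1
      set y := x - Pi.single a (x a) with hy
      have hya : y a = 0 := by simp [hy]
      have hyint : ∀ b, ∃ z : ℤ, y b = z := by
        intro b
        by_cases hb : b = a
        · exact ⟨0, by rw [hb, hya]; rfl⟩
        · obtain ⟨z, hz⟩ := hx b
          exact ⟨z, by rw [hy, Pi.sub_apply, Pi.single_eq_of_ne hb, hz, sub_zero]⟩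
      obtain ⟨b, hb, h3⟩ := exists_sub_single hyint (by rw [h1]; norm_num)
        (by rw [h1]; norm_num)
      rw [h1, show (2 : ℚ) - 1 - 1 = 0 by norm_num, dotProduct_self_eq_zero, sub_eq_zero] at h3
      have hab : a ≠ b := by
        rintro rfl
        rw [hya] at hb
        norm_num at hb
      have hxy : x = Pi.single a (x a) + Pi.single b (y b) := by
        rw [← h3, hy]
        abel
      rw [hxy]
      rcases hab.lt_or_gt with hlt | hlt <;> rcases ha with ha | ha <;> rcases hb with hb | hb <;>
        rw [ha, hb]
      · exact Or.inl (.add a b hlt)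
      · left
        rw [Pi.single_neg, ← sub_eq_add_neg]
        exact .sub a b hlt
      · right
        rw [Pi.single_neg, neg_add, neg_neg, ← sub_eq_add_neg]
        exact .sub a b hlt
      · right
        rw [Pi.single_neg, Pi.single_neg, neg_add, neg_neg, neg_neg]
        exact .add a b hlt
      · left
        rw [add_comm]
        exact .add b a hlt
      · right
        rw [Pi.single_neg, neg_add, neg_neg, add_comm, ← sub_eq_add_neg]
        exact .sub b a hlt
      · left
        rw [Pi.single_neg, add_comm, ← sub_eq_add_neg]
        exact .sub b a hlt
      · right
        rw [Pi.single_neg, Pi.single_neg, neg_add, neg_neg, neg_neg, add_comm]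
        exact .add b a hlt
  · rintro (h | h)
    · exact h.mem_shortIntegralVectors
    · rw [← neg_neg x]
      exact neg_mem_shortIntegralVectors h.mem_shortIntegralVectors

theorem corootVector_of_dotProduct_self_eq_two {x : Fin n → ℚ} (h : x ⬝ᵥ x = 2) :
    corootVector x = x := by
  rw [corootVector, h, div_self two_ne_zero, one_smul]

theorem corootVector_single (t : ℚ) (a : Fin n) :
    corootVector (t • Pi.single a 1 : Fin n → ℚ) = (2 / t) • Pi.single a 1 := by
  rw [corootVector_smul, corootVector]
  simp [smul_smul, div_eq_inv_mul]

/-- Vectors of square length 2 are their own coroots, while t e_a becomes (2/t) e_a; this exchanges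
the factors 1 and 2. -/
theorem IsChainRoot.corootVector {t : ℚ} {x : Fin n → ℚ} (hx : IsChainRoot t x) :
    IsChainRoot (2 / t) (corootVector x) := by
  rcases hx with ⟨a, b, h⟩ | ⟨a, b, h⟩ | a
  · rw [corootVector_of_dotProduct_self_eq_two (single_sub_single_dotProduct_self h.ne)]
    exact .sub a b h
  · rw [corootVector_of_dotProduct_self_eq_two (single_add_single_dotProduct_self h.ne)]
    exact .add a b h
  · rw [corootVector_single t]
    exact .single a

theorem isChainRoot_two_iff (x : Fin n → ℚ) : IsChainRoot 2 x ↔ IsChainRoot 1 (corootVector x) := by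
  constructor
  · intro h
    simpa using h.corootVector
  · intro h
    simpa [corootVector_corootVector] using h.corootVector

/-! ### Simple roots and Cartan matrices. -/

/-- The simple roots `e_i - e_{i+1}` and `t e_{n-1}`. -/
def chainSimple (t : ℚ) (i : Fin n) : Fin n → ℚ :=
  if h : (i : ℕ) + 1 < n then Pi.single i 1 - Pi.single ⟨i + 1, h⟩ 1 else t • Pi.single i 1

theorem isChainRoot_chainSimple (t : ℚ) (i : Fin n) : IsChainRoot t (chainSimple t i) := by
  unfold chainSimple
  split_ifs with h
  · exact .sub _ _ (Fin.lt_def.2 (Nat.lt_succ_self _))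
  · exact .single i

theorem corootVector_chainSimple (t : ℚ) (i : Fin n) :
    corootVector (chainSimple t i) = chainSimple (2 / t) i := by
  unfold chainSimple
  split_ifs with h
  · exact corootVector_of_dotProduct_self_eq_two
      (single_sub_single_dotProduct_self (Fin.ne_of_lt (Fin.lt_def.2 (Nat.lt_succ_self _))))
  · exact corootVector_single t i

/-- The difference telescopes into e_c - e_{c+1} for a ≤ c < b. -/
theorem single_sub_single_mem_closure (t : ℚ) {a b : Fin n} (hab : a ≤ b) :
    (Pi.single a 1 - Pi.single b 1 : Fin n → ℚ) ∈
      AddSubmonoid.closure (Set.range (chainSimple (n := n) t)) := by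
  obtain ⟨b, hb⟩ := b
  induction b with
  | zero =>
    obtain rfl : a = ⟨0, hb⟩ := Fin.ext (Nat.le_zero.1 hab)
    rw [sub_self]
    exact zero_mem _
  | succ b ih =>
    rcases hab.lt_or_eq with h | rfl
    · have h1 := ih (by omega) (Fin.le_def.2 (Nat.lt_succ_iff.1 (Fin.lt_def.1 h)))
      have h2 : chainSimple t (⟨b, by omega⟩ : Fin n) ∈
          AddSubmonoid.closure (Set.range (chainSimple (n := n) t)) :=
        AddSubmonoid.subset_closure ⟨_, rfl⟩
      rw [chainSimple, dif_pos hb] at h2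
      simpa using add_mem h1 h2
    · rw [sub_self]
      exact zero_mem _

theorem single_last_mem_closure (t : ℚ) {a : Fin n} (ha : (a : ℕ) + 1 = n) :
    (t • Pi.single a 1 : Fin n → ℚ) ∈
      AddSubmonoid.closure (Set.range (chainSimple (n := n) t)) := by
  refine AddSubmonoid.subset_closure ⟨a, ?_⟩
  rw [chainSimple, dif_neg (by omega)]

theorem IsChainRoot.mem_closure {t : ℚ} (ht : t = 1 ∨ t = 2) {x : Fin n → ℚ}
    (hx : IsChainRoot t x) : x ∈ AddSubmonoid.closure (Set.range (chainSimple (n := n) t)) := by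
  have hlast : ∀ _ : Fin n, ∃ l : Fin n, (l : ℕ) + 1 = n ∧ ∀ a, a ≤ l := fun a =>
    have ha := a.2
    ⟨⟨n - 1, by omega⟩, by dsimp only; omega, fun b => Fin.le_def.2 (by dsimp only; omega)⟩
  have hadd : ∀ a b : Fin n, (Pi.single a 1 + Pi.single b 1 : Fin n → ℚ) ∈
      AddSubmonoid.closure (Set.range (chainSimple (n := n) t)) := by
    intro a b
    obtain ⟨l, hl1, hl2⟩ := hlast a
    have hl := single_last_mem_closure t hl1
    have h1 := single_sub_single_mem_closure t (hl2 a)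
    have h2 := single_sub_single_mem_closure t (hl2 b)
    have h3 := add_mem h1 h2
    -- With l the last index, e_a + e_b = (e_a - e_l) + (e_b - e_l) + 2 e_l. The last term is twice
    -- the simple root e_l if t = 1, and the simple root itself if t = 2.
    rcases ht with rfl | rfl
    · convert add_mem (add_mem h3 hl) hl using 1
      module
    · convert add_mem h3 hl using 1
      module
  rcases hx with ⟨a, b, h⟩ | ⟨a, b, -⟩ | a
  · exact single_sub_single_mem_closure t h.le
  · exact hadd a b
  · rcases ht with rfl | rfl
    · obtain ⟨l, hl1, hl2⟩ := hlast a
      convert add_mem (single_sub_single_mem_closure 1 (hl2 a))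
        (single_last_mem_closure 1 hl1) using 1
      module
    · convert hadd a a using 1
      module

/-- The n simple roots span, because every t e_a is a sum of them and t ≠ 0. -/
theorem linearIndependent_chainSimple {t : ℚ} (ht : t = 1 ∨ t = 2) :
    LinearIndependent ℚ (chainSimple (n := n) t) := by
  have ht0 : t ≠ 0 := by rcases ht with rfl | rfl <;> norm_num
  refine linearIndependent_of_top_le_span_of_card_eq_finrank ?_ (by simp)
  rw [← (Pi.basisFun ℚ (Fin n)).span_eq, Submodule.span_le]
  rintro _ ⟨a, rfl⟩
  have h1 := (IsChainRoot.single (t := t) a).mem_closure ht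
  have h2 : AddSubmonoid.closure (Set.range (chainSimple (n := n) t)) ≤
      (Submodule.span ℚ (Set.range (chainSimple (n := n) t))).toAddSubmonoid :=
    AddSubmonoid.closure_le.2 Submodule.subset_span
  have h3 := Submodule.smul_mem _ t⁻¹ (h2 h1)
  rw [inv_smul_smul₀ ht0] at h3
  simpa using h3

theorem cartanMatrix_B_apply (i j : Fin n) : (CartanMatrix.B n i j : ℚ) =
    2 / (chainSimple 1 j ⬝ᵥ chainSimple 1 j) * (chainSimple 1 j ⬝ᵥ chainSimple 1 i) := by
  have hi := i.2
  have hj := j.2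
  -- The coroot of a simple root of `B_n` is the simple vector with factor 2, so no division remains
  -- in the case check.
  rw [corootVector_dotProduct, corootVector_chainSimple]
  unfold chainSimple CartanMatrix.B
  split_ifs with h1 h2 h2 <;>
    simp only [sub_dotProduct, dotProduct_sub, smul_dotProduct, dotProduct_smul,
      single_dotProduct, Pi.single_apply, Fin.ext_iff, of_apply, smul_eq_mul, one_mul] <;>
    split_ifs <;> first | omega | norm_num

/-- The simple roots of `C_n` are the coroots of those of `B_n`, and duality transposes the Cartan
matrix. -/
theorem cartanMatrix_C_apply (i j : Fin n) : (CartanMatrix.C n i j : ℚ) =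
    2 / (chainSimple 2 j ⬝ᵥ chainSimple 2 j) * (chainSimple 2 j ⬝ᵥ chainSimple 2 i) := by
  have h1 : ∀ i : Fin n, chainSimple 2 i = corootVector (chainSimple 1 i) := fun i => by
    rw [corootVector_chainSimple, div_one]
  rw [← CartanMatrix.B_transpose, transpose_apply, cartanMatrix_B_apply, corootVector_dotProduct,
    corootVector_dotProduct, h1, h1, corootVector_corootVector, dotProduct_comm]

theorem isPositiveRootsOfType_typeB_of_linearMap {X : Type} (Φ : (Fin n → ℚ) →ₗ[ℚ] X → ℚ)
    (hΦ : Function.Injective Φ) :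
    IsPositiveRootsOfType (Φ '' {x | IsChainRoot 1 x}) (CartanMatrix.B n)
      (fun i => Φ (chainSimple 1 i)) :=
  isPositiveRootsOfType_of_vectors Φ hΦ (finite_isChainRoot 1) mem_shortIntegralVectors_iff
    isRootVectors_shortIntegralVectors (isChainRoot_chainSimple 1)
    (linearIndependent_chainSimple (Or.inl rfl)) (fun _ hx => hx.mem_closure (Or.inl rfl))
    cartanMatrix_B_apply

theorem isPositiveRootsOfType_typeC_of_linearMap {X : Type} (Φ : (Fin n → ℚ) →ₗ[ℚ] X → ℚ)
    (hΦ : Function.Injective Φ) :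
    IsPositiveRootsOfType (Φ '' {x | IsChainRoot 2 x}) (CartanMatrix.C n)
      (fun i => Φ (chainSimple 2 i)) :=
  isPositiveRootsOfType_of_vectors Φ hΦ (finite_isChainRoot 2)
    (R := corootVector ⁻¹' shortIntegralVectors n)
    (fun x => by
      rw [Set.mem_preimage, mem_shortIntegralVectors_iff, ← corootVector_neg,
        ← isChainRoot_two_iff, ← isChainRoot_two_iff]
      rfl)
    isRootVectors_shortIntegralVectors.preimage_corootVector (isChainRoot_chainSimple 2)
    (linearIndependent_chainSimple (Or.inr rfl)) (fun _ hx => hx.mem_closure (Or.inr rfl))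
    cartanMatrix_C_apply

end

noncomputable section

/-! ### Comparison of the dimension vectors with the roots -/

namespace SignedQuiver

variable {n : ℕ} {o : Fin (n - 1) → Bool} {s : SignType} {Q : SignedQuiver} {m : ℕ}
  {pos : Q.Double → ℕ}

/-- The length factor of the roots attached to symmetric intervals. -/
def signFactor (s : SignType) : ℚ := if s = 1 then 1 else 2

theorem IsSymmetricChain.rootDim_of_add_eq (hQ : Q.IsSymmetricChain m pos s) {p q : ℕ}
    (hpq : p + q + 1 = m) (i : Q.Double) : (rootDim s (posInterval pos p q) i : ℚ) =
      signFactor s * if p ≤ pos i ∧ pos i ≤ q then 1 else 0 := by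
  have h : ∀ j : Q.Double, j.star ∈ posInterval pos p q ↔ j ∈ posInterval pos p q := by
    intro j
    have := hQ.pos_star j
    simp only [posInterval, Set.mem_ofPred_eq]
    omega
  have h2 : i ∈ posInterval pos p q ↔ p ≤ pos i ∧ pos i ≤ q := Iff.rfl
  unfold rootDim signFactor
  simp only [h, h2, implies_true, and_true]
  split_ifs <;> norm_num

/-- The mirror image of the left end p lies at m - 1 - p > q, so the interval is not self-dual and
the generic formula applies. -/
theorem IsSymmetricChain.rootDim_of_add_lt (hQ : Q.IsSymmetricChain m pos s) {p q : ℕ}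
    (hpq : p ≤ q) (hpm : p + q + 1 < m) (i : Q.Double) :
    (rootDim s (posInterval pos p q) i : ℚ) =
      (if p ≤ pos i ∧ pos i ≤ q then 1 else 0) +
        if m ≤ pos i + q + 1 ∧ pos i + p + 1 ≤ m then 1 else 0 := by
  obtain ⟨j, hj⟩ := hQ.chain.surj p (by omega)
  have h : ¬ ∀ j : Q.Double, j.star ∈ posInterval pos p q ↔ j ∈ posInterval pos p q := by
    intro h
    have h1 := ((h j).2 ⟨hj.ge, by omega⟩).2
    have := hQ.pos_star j
    omega
  have h1 : i ∈ posInterval pos p q ↔ p ≤ pos i ∧ pos i ≤ q := Iff.rfl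
  have h2 : i.star ∈ posInterval pos p q ↔ m ≤ pos i + q + 1 ∧ pos i + p + 1 ≤ m := by
    have := hQ.pos_star i
    simp only [posInterval, Set.mem_ofPred_eq]
    omega
  unfold rootDim
  simp only [h, h1, h2, and_false, if_false]
  push_cast
  rfl

/-- The interval `[p, q]` and its image under the involution have the same dimension vector. -/
theorem IsSymmetricChain.rootDim_reverse (hQ : Q.IsSymmetricChain m pos s) {p q p' q' : ℕ}
    (hp : p + q' + 1 = m) (hq : q + p' + 1 = m) :
    rootDim s (posInterval pos p q) = rootDim s (posInterval pos p' q') := by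
  rw [← rootDim_star s (posInterval pos p' q')]
  congr 1
  ext i
  have := hQ.pos_star i
  simp only [posInterval, Set.mem_ofPred_eq, Set.mem_preimage]
  omega

/-- The embedding of the Euclidean space into the space of dimension vectors which sends the vector
`e_a` to the indicator of the symmetric interval starting at `a`. -/
def chainEmbedding (n : ℕ) (o : Fin (n - 1) → Bool) (s : SignType) :
    (Fin n → ℚ) →ₗ[ℚ] (chain n o s).Double → ℚ :=
  LinearMap.pi fun i => ∑ a : Fin n,
    -- The second inequality is pos i ≤ 2n - 2 - a, written without subtraction.
    (if (a : ℕ) ≤ chainPos n o s i ∧ chainPos n o s i + a + 2 ≤ 2 * n then (1 : ℚ) else 0) •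
      LinearMap.proj a

theorem chainEmbedding_apply (x : Fin n → ℚ) (i : (chain n o s).Double) :
    chainEmbedding n o s x i = ∑ a : Fin n,
      (if (a : ℕ) ≤ chainPos n o s i ∧ chainPos n o s i + a + 2 ≤ 2 * n then (1 : ℚ) else 0) *
        x a := by
  simp only [chainEmbedding, LinearMap.pi_apply, LinearMap.sum_apply, LinearMap.smul_apply,
    LinearMap.proj_apply, smul_eq_mul]

theorem chainEmbedding_single (a : Fin n) (i : (chain n o s).Double) :
    chainEmbedding n o s (Pi.single a 1) i =
      if (a : ℕ) ≤ chainPos n o s i ∧ chainPos n o s i + a + 2 ≤ 2 * n then 1 else 0 := by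
  rw [chainEmbedding_apply, Finset.sum_eq_single_of_mem a (Finset.mem_univ a)]
  · rw [Pi.single_eq_same, mul_one]
  · intro b _ hb
    rw [Pi.single_eq_of_ne hb, mul_zero]

/-- At position p < n the image of x is the sum of the coordinates x_a with a ≤ p, a unitriangular
system. -/
theorem chainEmbedding_injective : Function.Injective (chainEmbedding n o s) := by
  rw [← LinearMap.ker_eq_bot, LinearMap.ker_eq_bot']
  intro x hx
  have key : ∀ p (h : p < n), x ⟨p, h⟩ = 0 := by
    intro p
    induction p using Nat.strong_induction_on with
    | _ p ih =>
      intro h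
      let i : (chain n o s).Double := .of (⟨p, h⟩ : Fin n)
      have hi : chainPos n o s i = p := rfl
      have h1 := congrFun hx i
      rw [chainEmbedding_apply, Finset.sum_eq_single_of_mem ⟨p, h⟩ (Finset.mem_univ _), hi,
        if_pos (by dsimp only; omega), one_mul] at h1
      · exact h1
      · intro b _ hb
        rw [hi]
        rcases lt_trichotomy (b : ℕ) p with hlt | heq | hgt
        · rw [ih b hlt b.2, mul_zero]
        · exact absurd (Fin.ext heq) hb
        · rw [if_neg (by omega), zero_mul]
  funext a
  exact key a a.2

/-- Symmetric intervals give t e_a. Any other interval may be reversed so that p + q < 2n - 2; then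
it gives a difference if it lies left of the middle vertex, and a sum if it contains it. -/
theorem symDims_chain {k : Type u} [Field k] (hk : (2 : k) ≠ 0) (hn : 1 ≤ n) (hs : s ≠ 0) :
    symDims k (chain n o s) = chainEmbedding n o s '' {x | IsChainRoot (signFactor s) x} := by
  have hQ := isSymmetricChain_chain (o := o) hn hs
  rw [symDims_eq hk hQ hs]
  ext d
  constructor
  · rintro ⟨p, q, hpq, hq, hd⟩
    have key : ∀ p q, p ≤ q → p + q + 1 < 2 * n - 1 → ∃ x : Fin n → ℚ,
        IsChainRoot (signFactor s) x ∧ ∀ i, chainEmbedding n o s x i =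
          (rootDim s (posInterval (chainPos n o s) p q) i : ℚ) := by
      intro p q hpq hlt
      by_cases hqn : q + 1 < n
      -- Removing [q + 1, 2n - 3 - q] from [p, 2n - 2 - p] leaves [p, q] and its mirror image.
      · refine ⟨_, .sub ⟨p, by omega⟩ ⟨q + 1, hqn⟩ (Fin.lt_def.2 (by dsimp only; omega)),
          fun i => ?_⟩
        have := hQ.pos_star i
        rw [hQ.rootDim_of_add_lt hpq hlt, map_sub, Pi.sub_apply, chainEmbedding_single,
          chainEmbedding_single]
        dsimp only
        split_ifs <;> first | omega | norm_num
      -- The interval [p, q] and its mirror image overlap: their union is [p, 2n - 2 - p] and their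
      -- intersection is [2n - 2 - q, q], whence the sum.
      · refine ⟨_, .add ⟨p, by omega⟩ ⟨2 * n - 2 - q, by omega⟩
          (Fin.lt_def.2 (by dsimp only; omega)), fun i => ?_⟩
        have := hQ.pos_star i
        rw [hQ.rootDim_of_add_lt hpq hlt, map_add, Pi.add_apply, chainEmbedding_single,
          chainEmbedding_single]
        dsimp only
        split_ifs <;> first | omega | norm_num
    rcases lt_trichotomy (p + q + 1) (2 * n - 1) with h | h | h
    · obtain ⟨x, hx, hxd⟩ := key p q hpq h
      exact ⟨x, hx, funext fun i => (hxd i).trans (hd i).symm⟩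
    · refine ⟨_, .single ⟨p, by omega⟩, funext fun i => ?_⟩
      rw [hd, hQ.rootDim_of_add_eq h, map_smul, Pi.smul_apply, chainEmbedding_single, smul_eq_mul]
      congr 1
      refine if_congr ?_ rfl rfl
      dsimp only
      omega
    · obtain ⟨x, hx, hxd⟩ := key (2 * n - 2 - q) (2 * n - 2 - p) (by omega) (by omega)
      refine ⟨x, hx, funext fun i => ?_⟩
      rw [hxd, hd, hQ.rootDim_reverse (p := p) (q := q) (p' := 2 * n - 2 - q)
        (q' := 2 * n - 2 - p) (by omega) (by omega)]
  · rintro ⟨x, hx, rfl⟩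
    rcases hx with ⟨a, b, h⟩ | ⟨a, b, h⟩ | a
    · have h := Fin.lt_def.1 h
      refine ⟨a, b - 1, by omega, by omega, fun i => ?_⟩
      have := hQ.pos_star i
      rw [hQ.rootDim_of_add_lt (by omega) (by omega), map_sub, Pi.sub_apply,
        chainEmbedding_single, chainEmbedding_single]
      split_ifs <;> first | omega | norm_num
    · have h := Fin.lt_def.1 h
      refine ⟨a, 2 * n - 2 - b, by omega, by omega, fun i => ?_⟩
      have := hQ.pos_star i
      rw [hQ.rootDim_of_add_lt (by omega) (by omega), map_add, Pi.add_apply,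
        chainEmbedding_single, chainEmbedding_single]
      split_ifs <;> first | omega | norm_num
    · refine ⟨a, 2 * n - 2 - a, by omega, by omega, fun i => ?_⟩
      rw [hQ.rootDim_of_add_eq (by omega), map_smul, Pi.smul_apply, chainEmbedding_single,
        smul_eq_mul]
      congr 1
      refine if_congr ?_ rfl rfl
      omega

theorem single_chain_apply (hs : s ≠ 0) (i j : (chain n o s).Double) (t : ℚ) :
    (open Classical in (Pi.single i t : (chain n o s).Double → ℚ)) j =
      if chainPos n o s j = chainPos n o s i then t else 0 := by
  classical
  rw [Pi.single_apply]
  exact if_congr (chainPos_injective hs).eq_iff.symm rfl rfl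

theorem chainEmbedding_chainSimple (hs : s ≠ 0) (i : Fin n) :
    chainEmbedding n o s (chainSimple (signFactor s) i) = simpleVector (chain n o s) i := by
  classical
  funext j
  have hv : (chain n o s).vsign i = if (i : ℕ) + 1 = n then s else 0 := rfl
  have hi : chainPos n o s (.of i) = (i : ℕ) := rfl
  have h1 := chainPos_star (o := o) hs (.of i)
  have h2 := chainPos_star hs j
  have h3 := i.2
  unfold chainSimple simpleVector
  rw [hv]
  by_cases h : (i : ℕ) + 1 = n
  -- The symmetric interval starting at the last index n - 1 is the middle vertex alone.
  · rw [dif_neg (by omega), if_pos h, map_smul, Pi.smul_apply, chainEmbedding_single, smul_eq_mul]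
    unfold signFactor
    by_cases hs1 : s = 1
    · rw [if_pos hs1, if_pos hs1, single_chain_apply hs]
      split_ifs <;> first | omega | norm_num
    · have hs2 : s = -1 := by
        revert hs hs1
        clear * -
        revert s
        decide
      rw [if_neg hs1, if_neg hs1, if_pos hs2, single_chain_apply hs]
      split_ifs <;> first | omega | norm_num
  -- The symmetric intervals starting at i and i + 1 differ exactly in the positions i and 2n - 2 -
  -- i, those of the vertex and its twin.
  · rw [dif_pos (by omega), if_neg h, if_neg (by decide), if_neg (by decide), map_sub,
      Pi.sub_apply, Pi.add_apply, chainEmbedding_single, chainEmbedding_single,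
      single_chain_apply hs, single_chain_apply hs]
    dsimp only
    split_ifs <;> first | omega | norm_num

end SignedQuiver

end

theorem theorem6p3 {k : Type u} [Field k] (hk : (2 : k) ≠ 0) (n : ℕ) (hn : 1 ≤ n)
    (o : Fin (n - 1) → Bool) :
    IsPositiveRootsOfType (SignedQuiver.symDims k (SignedQuiver.typeB n o)) (CartanMatrix.B n)
        (SignedQuiver.simpleVector (SignedQuiver.typeB n o)) ∧
      IsPositiveRootsOfType (SignedQuiver.symDims k (SignedQuiver.typeC n o)) (CartanMatrix.C n)
        (SignedQuiver.simpleVector (SignedQuiver.typeC n o)) := by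
  constructor
  · have h1 : SignedQuiver.signFactor 1 = 1 := if_pos rfl
    have hs : (1 : SignType) ≠ 0 := by decide
    have h := isPositiveRootsOfType_typeB_of_linearMap (SignedQuiver.chainEmbedding n o 1)
      SignedQuiver.chainEmbedding_injective
    have h2 : (fun i => SignedQuiver.chainEmbedding n o 1
        (chainSimple (SignedQuiver.signFactor 1) i)) =
          SignedQuiver.simpleVector (SignedQuiver.chain n o 1) :=
      funext (SignedQuiver.chainEmbedding_chainSimple hs)
    rw [← h1, ← SignedQuiver.symDims_chain hk hn hs, h2] at h
    exact h
  · have h1 : SignedQuiver.signFactor (-1) = 2 := if_neg (by decide)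
    have hs : (-1 : SignType) ≠ 0 := by decide
    have h := isPositiveRootsOfType_typeC_of_linearMap (SignedQuiver.chainEmbedding n o (-1))
      SignedQuiver.chainEmbedding_injective
    have h2 : (fun i => SignedQuiver.chainEmbedding n o (-1)
        (chainSimple (SignedQuiver.signFactor (-1)) i)) =
          SignedQuiver.simpleVector (SignedQuiver.chain n o (-1)) :=
      funext (SignedQuiver.chainEmbedding_chainSimple hs)
    rw [← h1, ← SignedQuiver.symDims_chain hk hn hs, h2] at h
    exact h
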